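/- Let $d\ge 1$, let $\mathbb B=\{x\in\mathbb R^d:|x|\le 1\}$, and let $q\ge 4$ be an even integer. With $\widehat f(\xi)=\int_{\mathbb R^d}e^{-2\pi i x\cdot\xi}f(x)\,dx$, let $K_q$ and $L_q$ be the (real-valued) functions on $\mathbb R^d$ determined by $$\widehat{K_q}=|\widehat{1_{\mathbb B}}|^{q-2}\,\widehat{1_{\mathbb B}},\qquad \widehat{L_q}=|\widehat{1_{\mathbb B}}|^{q-2},$$ that is, the inverse Fourier transforms of the right-hand sides. Let $L^2(\mathbb B)$ be the Hilbert space of real-valued square-integrable functions on $\mathbb B$, and for $h\in L^2(\mathbb B)$ put $\tilde h(x)=h(-x)$. Let $\mathcal H\subset L^2(\mathbb B)$ be the subspace of the functions $K_q(x)^{1/2}(a\cdot x+b)$ with $a\in\mathbb R^d$, $b\in\mathbb R$, and let $P_{\mathcal H}$ be the orthogonal projection of $L^2(\mathbb B)$ onto $\mathcal H$. Then the formula $$T_qh=\Big.K_q^{-1/2}\big((K_q^{-1/2}h1_{\mathbb B})*L_q\big)\Big|_{\mathbb B}$$ defines a bounded, compact, self-adjoint operator $T_q$ on $L^2(\mathbb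 B)$, and, with $Q_q(f,h)=\langle f,T_qh\rangle$, there exists $c>0$, depending only on $d$ and $q$, such that for every $h\in L^2(\mathbb B)$ $$-\frac q2\|h\|_{L^2(\mathbb B)}^2-\frac14q(q-2)\,Q_q(h,\tilde h)+\frac14q^2\,Q_q(h,h)\le -c\,\|(I-P_{\mathcal H})h\|_{L^2(\mathbb B)}^2 .$$ -/

import Mathlib

open MeasureTheory
open scoped FourierTransform Convolution

noncomputable section

namespace BallSpectral

/-- `ℝ^d` with its Euclidean norm and Lebesgue measure. -/
abbrev Rd (d : ℕ) : Type := EuclideanSpace ℝ (Fin d)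

/-- The unit ball of `ℝ^d`. -/
def unitBall (d : ℕ) : Set (Rd d) := Metric.closedBall 0 1

/-- Lebesgue measure on the unit ball. -/
def ballMeasure (d : ℕ) : Measure (Rd d) := volume.restrict (unitBall d)

/-- The real Hilbert space `L²(𝔹)`. -/
abbrev L2Ball (d : ℕ) : Type := Lp ℝ 2 (ballMeasure d)

/-- The Fourier transform of the indicator function of the unit ball,
`ξ ↦ ∫_𝔹 e^{-2π i x·ξ} dx`. -/
def ballHat (d : ℕ) : Rd d → ℂ := 𝓕 ((unitBall d).indicator (fun _ => (1 : ℂ)))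

/-- The function `|1̂_𝔹|^{q-2} 1̂_𝔹`. -/
def KHat (d : ℕ) (q : ℝ) (ξ : Rd d) : ℂ :=
  ((‖ballHat d ξ‖ ^ (q - 2) : ℝ) : ℂ) * ballHat d ξ

/-- The function `|1̂_𝔹|^{q-2}`. -/
def LHat (d : ℕ) (q : ℝ) (ξ : Rd d) : ℂ := ((‖ballHat d ξ‖ ^ (q - 2) : ℝ) : ℂ)

/-- `K_q`, the inverse Fourier transform of `|1̂_𝔹|^{q-2} 1̂_𝔹`; that inverse transform is
real-valued (`ofReal_K`), so taking the real part only changes the codomain. -/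
def K (d : ℕ) (q : ℝ) (x : Rd d) : ℝ := (𝓕⁻ (KHat d q) x).re

/-- `L_q`, the inverse Fourier transform of `|1̂_𝔹|^{q-2}`; that inverse transform is
real-valued (`ofReal_L`), so taking the real part only changes the codomain. -/
def L (d : ℕ) (q : ℝ) (x : Rd d) : ℝ := (𝓕⁻ (LHat d q) x).re

theorem neg_mem_unitBall {d : ℕ} {x : Rd d} : -x ∈ unitBall d ↔ x ∈ unitBall d := by
  simp [unitBall]

theorem ballHat_neg (d : ℕ) (ξ : Rd d) : ballHat d (-ξ) = ballHat d ξ := by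
  unfold ballHat
  rw [Real.fourier_eq, Real.fourier_eq, ← integral_neg_eq_self]
  congr 1
  ext v
  simp only [inner_neg_neg]
  congr 1
  by_cases h : v ∈ unitBall d
  · rw [Set.indicator_of_mem h, Set.indicator_of_mem (neg_mem_unitBall.mpr h)]
  · rw [Set.indicator_of_notMem h, Set.indicator_of_notMem (mt neg_mem_unitBall.mp h)]

theorem conj_ballHat (d : ℕ) (ξ : Rd d) :
    (starRingEnd ℂ) (ballHat d ξ) = ballHat d ξ := by
  conv_rhs => rw [← ballHat_neg]
  unfold ballHat
  rw [Real.fourier_eq', Real.fourier_eq', ← integral_conj]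
  congr 1
  ext v
  by_cases h : v ∈ unitBall d <;> simp [h, ← Complex.exp_conj, Complex.conj_ofNat]

theorem conj_fourierInv {d : ℕ} (G : Rd d → ℂ) (hG : ∀ ξ, (starRingEnd ℂ) (G ξ) = G (-ξ))
    (x : Rd d) : (starRingEnd ℂ) (𝓕⁻ G x) = 𝓕⁻ G x := by
  rw [Real.fourierInv_eq', ← integral_conj, ← integral_neg_eq_self]
  congr 1
  ext v
  simp [hG, ← Complex.exp_conj, Complex.conj_ofNat]

theorem ofReal_K (d : ℕ) (q : ℝ) (x : Rd d) : (K d q x : ℂ) = 𝓕⁻ (KHat d q) x :=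
  Complex.conj_eq_iff_re.mp (conj_fourierInv _ (fun ξ => by
    simp only [KHat, map_mul, conj_ballHat, ballHat_neg, Complex.conj_ofReal]) x)

theorem ofReal_L (d : ℕ) (q : ℝ) (x : Rd d) : (L d q x : ℂ) = 𝓕⁻ (LHat d q) x :=
  Complex.conj_eq_iff_re.mp (conj_fourierInv _ (fun ξ => by
    simp only [LHat, ballHat_neg, Complex.conj_ofReal]) x)

theorem continuous_K (d : ℕ) (q : ℝ) : Continuous (K d q) := by
  unfold K
  refine Complex.continuous_re.comp ?_
  have he : 𝓕⁻ (KHat d q) = fun x => 𝓕 (KHat d q) (-x) :=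
    funext fun x => Real.fourierInv_eq_fourier_neg _ _
  rw [he]
  by_cases h : Integrable (KHat d q)
  · have hc : Continuous (𝓕 (KHat d q)) :=
      VectorFourier.fourierIntegral_continuous Real.continuous_fourierChar
        (L := innerₗ (Rd d)) continuous_inner h
    exact hc.comp continuous_neg
  · have h0 : ∀ x, 𝓕 (KHat d q) x = 0 := fun x => by
      rw [Real.fourier_eq]
      refine integral_undef ?_
      rwa [Real.fourierIntegral_convergent_iff]
    simp only [h0]
    exact continuous_const

instance instIsFiniteMeasureBallMeasure (d : ℕ) : IsFiniteMeasure (ballMeasure d) :=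
  ⟨by
    rw [ballMeasure, Measure.restrict_apply_univ]
    exact measure_closedBall_lt_top⟩

/-- The function `K_q(x)^{1/2} (a·x + b)`. -/
def affineFun (d : ℕ) (q : ℝ) (p : Rd d × ℝ) (x : Rd d) : ℝ :=
  √(K d q x) * (inner ℝ p.1 x + p.2)

theorem memLp_affineFun (d : ℕ) (q : ℝ) (p : Rd d × ℝ) :
    MemLp (affineFun d q p) 2 (ballMeasure d) := by
  have hc : Continuous (affineFun d q p) := by
    unfold affineFun
    have := continuous_K d q
    fun_prop
  obtain ⟨C, hC⟩ := (isCompact_closedBall (0 : Rd d) 1).exists_bound_of_continuousOn hc.continuousOn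
  refine MemLp.of_bound hc.aestronglyMeasurable C ?_
  exact (ae_restrict_iff' Metric.isClosed_closedBall.measurableSet).mpr (ae_of_all _ hC)

/-- The linear map sending `(a, b)` to the class of `K_q(x)^{1/2} (a·x + b)` in `L²(𝔹)`. -/
def affineMap (d : ℕ) (q : ℝ) : (Rd d × ℝ) →ₗ[ℝ] L2Ball d where
  toFun p := (memLp_affineFun d q p).toLp
  map_add' p p' := by
    rw [← MemLp.toLp_add]
    refine MemLp.toLp_congr _ _ (ae_of_all _ fun x => ?_)
    simp only [affineFun, Prod.fst_add, Prod.snd_add, inner_add_left, Pi.add_apply]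
    ring
  map_smul' c p := by
    rw [RingHom.id_apply, ← MemLp.toLp_const_smul]
    refine MemLp.toLp_congr _ _ (ae_of_all _ fun x => ?_)
    simp only [affineFun, Prod.smul_fst, Prod.smul_snd, inner_smul_left, Pi.smul_apply,
      smul_eq_mul, conj_trivial]
    ring

/-- The subspace `ℋ` of `L²(𝔹)` of the functions `K_q(x)^{1/2} (a·x + b)`, `a ∈ ℝ^d`, `b ∈ ℝ`. -/
def H (d : ℕ) (q : ℝ) : Submodule ℝ (L2Ball d) := LinearMap.range (affineMap d q)

instance instFiniteDimensionalH (d : ℕ) (q : ℝ) : FiniteDimensional ℝ (H d q) := by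
  unfold H
  infer_instance

theorem measurePreserving_neg_ball (d : ℕ) :
    MeasurePreserving (fun x : Rd d => -x) (ballMeasure d) (ballMeasure d) := by
  have h := (Measure.measurePreserving_neg (volume : Measure (Rd d))).restrict_preimage
    (s := unitBall d) Metric.isClosed_closedBall.measurableSet
  have h2 : Neg.neg ⁻¹' unitBall d = unitBall d := Set.ext fun x => neg_mem_unitBall
  rw [h2] at h
  exact h

/-- The reflection `h ↦ h̃`, `h̃(x) = h(-x)`, on `L²(𝔹)`. -/
def reflection (d : ℕ) (h : L2Ball d) : L2Ball d :=
  Lp.compMeasurePreserving (fun x : Rd d => -x) (measurePreserving_neg_ball d) h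

/-- The function `K_q^{-1/2} ((K_q^{-1/2} h 1_𝔹) ∗ L_q)`. -/
def TFun (d : ℕ) (q : ℝ) (h : Rd d → ℝ) (x : Rd d) : ℝ :=
  (√(K d q x))⁻¹ *
    (((unitBall d).indicator fun y => (√(K d q y))⁻¹ * h y)
      ⋆[ContinuousLinearMap.mul ℝ ℝ, volume] L d q) x

/-- `T` is the operator `T_q` on `L²(𝔹)`: for every `h`, the function `T h` is the restriction to `𝔹` of
`K_q^{-1/2} ((K_q^{-1/2} h 1_𝔹) ∗ L_q)`. There is at most one such `T`. -/
def IsT (d : ℕ) (q : ℝ) (T : L2Ball d →L[ℝ] L2Ball d) : Prop :=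
  ∀ h : L2Ball d, T h =ᵐ[ballMeasure d] TFun d q h

/-- The form `Q(f, h) = ⟨f, T h⟩` of an operator `T` on `L²(𝔹)`. -/
def Q {d : ℕ} (T : L2Ball d →L[ℝ] L2Ball d) (f h : L2Ball d) : ℝ := inner ℝ f (T h)

end BallSpectral

end

noncomputable section

namespace BallSpectral

open Filter Topology

/-! Write q = k + 4. The transform `ballHat` is real, so for even q its powers carry no absolute
value, and L_q and K_q are the (q-2)-fold and (q-1)-fold convolution powers of 1_𝔹 (`L_eq_ballPow`,
`K_eq_ballPow`). In particular K_q = 1_𝔹 * L_q, and K_q is positive on the closed ball. Substituting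
h = K_q^{1/2} f gives ‖h‖² = ∫ f² K_q and Q(h,h) = ∬ f(x) f(y) L_q(x-y), both integrals over the
ball.

The quadratic form of the theorem is -(q/2)⟨h, (1 - C)h⟩ with C = (q/2) T - ((q-2)/2) T R, where R
is the reflection. Since T commutes with R, C acts as T on even functions and as (q-1) T on odd
ones, and the two parities decouple.

On each parity 1 - C is a sum of squares. For every f, 2(‖h‖² - Q(h,h)) is the integral of
(f(x)-f(y))² L_q(x-y) (`integral_sub_sq`). For odd f, q(‖h‖² - (q-1) Q(h,h)) is the integral of (∑
f(x_i) - f(∑ x_i))² over q-1 points of the ball whose sum is in the ball (`integral_sum_sub_sq`).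
Hence 1 - C ≥ 0. Its even null vectors come from constant f, and its odd ones from f additive on the
ball, hence linear (`exists_eq_inner_of_add`), so the kernel is exactly ℋ (`mem_H_iff`).

As C is compact and self-adjoint, the Fredholm alternative turns this knowledge of the kernel into a
quantitative lower bound on the complement of ℋ (`exists_gap_of_isCompactOperator`). -/

theorem measurableSet_unitBall (d : ℕ) : MeasurableSet (unitBall d) :=
  Metric.isClosed_closedBall.measurableSet

/-! ### Convolution powers of the indicator of the ball. -/

/-- The `(k+1)`-fold convolution power of the indicator function of the unit ball. -/
def ballPow (d : ℕ) : ℕ → Rd d → ℝ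
  | 0 => (unitBall d).indicator fun _ => 1
  | k + 1 => fun x => ∫ y, ballPow d k (x - y) ∂ballMeasure d

theorem ballPow_zero_of_mem {d : ℕ} {x : Rd d} (hx : x ∈ unitBall d) : ballPow d 0 x = 1 :=
  Set.indicator_of_mem hx _

theorem ballPow_zero_of_notMem {d : ℕ} {x : Rd d} (hx : x ∉ unitBall d) : ballPow d 0 x = 0 :=
  Set.indicator_of_notMem hx _

theorem ballPow_succ (d k : ℕ) (x : Rd d) :
    ballPow d (k + 1) x = ∫ y, ballPow d k (x - y) ∂ballMeasure d := rfl

theorem ballPow_nonneg (d k : ℕ) (x : Rd d) : 0 ≤ ballPow d k x := by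
  induction k generalizing x with
  | zero => exact Set.indicator_nonneg (fun _ _ => zero_le_one) x
  | succ k ih => exact integral_nonneg fun y => ih _

theorem measurable_ballPow (d k : ℕ) : Measurable (ballPow d k) := by
  induction k with
  | zero => exact measurable_const.indicator (measurableSet_unitBall d)
  | succ k ih =>
    have : StronglyMeasurable (Function.uncurry fun x y : Rd d => ballPow d k (x - y)) :=
      (ih.comp (measurable_fst.sub measurable_snd)).stronglyMeasurable
    exact this.integral_prod_right.measurable

theorem exists_ballPow_le (d k : ℕ) : ∃ C, ∀ x, ballPow d k x ≤ C := by
  induction k with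
  | zero => exact ⟨1, fun x => Set.indicator_le_self' (by simp) x⟩
  | succ k ih =>
    obtain ⟨C, hC⟩ := ih
    refine ⟨C * (ballMeasure d).real Set.univ, fun x => ?_⟩
    refine (Real.le_norm_self _).trans
      (norm_integral_le_of_norm_le_const (μ := ballMeasure d)
        (f := fun y => ballPow d k (x - y)) (ae_of_all _ fun y => ?_))
    rw [Real.norm_of_nonneg (ballPow_nonneg d k _)]
    exact hC _

theorem ballPow_neg (d k : ℕ) (x : Rd d) : ballPow d k (-x) = ballPow d k x := by
  induction k generalizing x with
  | zero =>
    by_cases h : x ∈ unitBall d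
    · simp [ballPow, h, neg_mem_unitBall.mpr h]
    · simp [ballPow, h, mt neg_mem_unitBall.mp h]
  | succ k ih =>
    simp only [ballPow]
    have h := (measurePreserving_neg_ball d).integral_comp
      (MeasurableEquiv.neg (Rd d)).measurableEmbedding (fun y => ballPow d k (-x - y))
    rw [← h]
    refine integral_congr_ae (ae_of_all _ fun y => ?_)
    simp only
    rw [← ih]
    congr 1
    abel

theorem ballPow_eq_zero (d k : ℕ) {x : Rd d} (hx : (k : ℝ) + 1 < ‖x‖) : ballPow d k x = 0 := by
  induction k generalizing x with
  | zero =>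
    refine Set.indicator_of_notMem ?_ _
    simpa [unitBall] using hx
  | succ k ih =>
    refine integral_eq_zero_of_ae ?_
    filter_upwards [ae_restrict_mem (measurableSet_unitBall d)] with y hy
    refine ih ?_
    have h1 : ‖y‖ ≤ 1 := by simpa [unitBall] using hy
    have h2 := norm_sub_norm_le x y
    push_cast at hx
    linarith

theorem hasCompactSupport_ballPow (d k : ℕ) : HasCompactSupport (ballPow d k) := by
  refine HasCompactSupport.of_support_subset_isCompact
    (isCompact_closedBall (0 : Rd d) ((k : ℝ) + 1)) fun x hx => ?_
  by_contra h
  exact hx (ballPow_eq_zero d k (by simpa using h))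

theorem integrable_ballPow (d k : ℕ) : Integrable (ballPow d k) := by
  obtain ⟨C, hC⟩ := exists_ballPow_le d k
  have h : IntegrableOn (ballPow d k) (tsupport (ballPow d k)) :=
    Measure.integrableOn_of_bounded (M := C) (hasCompactSupport_ballPow d k).measure_lt_top.ne
      (measurable_ballPow d k).aestronglyMeasurable
      (ae_of_all _ fun x => by rw [Real.norm_of_nonneg (ballPow_nonneg d k _)]; exact hC x)
  exact (integrableOn_iff_integrable_of_support_subset (subset_tsupport _)).mp h

/-- Dominated convergence needs continuity of the integrand only almost everywhere, which also
covers the first step, where the indicator jumps on the null unit sphere. -/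
theorem continuous_ballPow_succ_of_ae {d k : ℕ}
    (h : ∀ᵐ z : Rd d, ContinuousAt (ballPow d k) z) : Continuous (ballPow d (k + 1)) := by
  obtain ⟨C, hC⟩ := exists_ballPow_le d k
  refine continuous_iff_continuousAt.mpr fun x₀ => ?_
  refine continuousAt_of_dominated (bound := fun _ => C) ?_ ?_ (integrable_const _) ?_
  · exact Eventually.of_forall fun x =>
      ((measurable_ballPow d k).comp (measurable_const.sub measurable_id)).aestronglyMeasurable
  · refine Eventually.of_forall fun x => ae_of_all _ fun y => ?_
    rw [Real.norm_of_nonneg (ballPow_nonneg d k _)]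
    exact hC _
  · refine ae_restrict_of_ae ?_
    have h' := (Measure.measurePreserving_sub_left (volume : Measure (Rd d)) x₀
      ).quasiMeasurePreserving.ae h
    filter_upwards [h'] with y hy
    exact ContinuousAt.comp (f := fun x => x - y) hy (by fun_prop)

theorem continuous_ballPow_succ (d k : ℕ) : Continuous (ballPow d (k + 1)) := by
  induction k with
  | zero =>
    refine continuous_ballPow_succ_of_ae ?_
    have h0 : volume (Metric.sphere (0 : Rd d) 1) = 0 :=
      Measure.addHaar_sphere_of_ne_zero _ _ one_ne_zero
    filter_upwards [measure_eq_zero_iff_ae_notMem.mp h0] with z hz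
    rcases lt_or_gt_of_ne (show ‖z‖ ≠ 1 by simpa using hz) with h | h
    · refine (continuousAt_const (y := (1 : ℝ))).congr ?_
      filter_upwards [Metric.isOpen_ball.mem_nhds (show z ∈ Metric.ball 0 1 by simpa using h)]
        with w hw
      have hw' : w ∈ unitBall d := Metric.ball_subset_closedBall hw
      simp [ballPow, hw']
    · refine (continuousAt_const (y := (0 : ℝ))).congr ?_
      filter_upwards [Metric.isClosed_closedBall.isOpen_compl.mem_nhds
        (show z ∈ (Metric.closedBall 0 1)ᶜ by simpa using h)] with w hw
      have hw' : w ∉ unitBall d := hw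
      simp [ballPow, hw']
  | succ k ih => exact continuous_ballPow_succ_of_ae (ae_of_all _ fun z => ih.continuousAt)

theorem ballPow_pos (d k : ℕ) {x : Rd d} (hx : ‖x‖ < (k : ℝ) + 1) : 0 < ballPow d k x := by
  induction k generalizing x with
  | zero =>
    have : x ∈ unitBall d := by
      simp only [Nat.cast_zero, zero_add] at hx
      simpa [unitBall] using hx.le
    simp [ballPow, this]
  | succ k ih =>
    obtain ⟨C, hC⟩ := exists_ballPow_le d k
    have hm : Measurable fun y => ballPow d k (x - y) :=
      (measurable_ballPow d k).comp (measurable_const.sub measurable_id)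
    have hi : Integrable (fun y => ballPow d k (x - y)) (ballMeasure d) :=
      Integrable.of_bound hm.aestronglyMeasurable C (ae_of_all _ fun y => by
        rw [Real.norm_of_nonneg (ballPow_nonneg d k _)]; exact hC _)
    refine (integral_pos_iff_support_of_nonneg (fun y => ballPow_nonneg d k _) hi).mpr ?_
    have hk : (0 : ℝ) < k + 2 := by positivity
    push_cast at hx
    set U : Set (Rd d) := Metric.ball 0 1 ∩ Metric.ball x (k + 1)
    have hU : IsOpen U := Metric.isOpen_ball.inter Metric.isOpen_ball
    have hne : U.Nonempty := by
      -- The point x/(k+2) has norm less than 1 and lies at distance (k+1)‖x‖/(k+2) < k+1 from x.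
      refine ⟨((k : ℝ) + 2)⁻¹ • x, ?_, ?_⟩
      · rw [mem_ball_zero_iff, norm_smul, Real.norm_of_nonneg (by positivity),
          inv_mul_lt_iff₀ hk]
        linarith
      · rw [mem_ball_iff_norm]
        have : ((k : ℝ) + 2)⁻¹ • x - x = -((((k : ℝ) + 1) / (k + 2)) • x) := by
          rw [← neg_smul]
          nth_rewrite 2 [← one_smul ℝ x]
          rw [← sub_smul]
          congr 1
          field_simp
          ring
        rw [this, norm_neg, norm_smul, Real.norm_of_nonneg (by positivity), div_mul_eq_mul_div,
          div_lt_iff₀ hk]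
        have : (0 : ℝ) < k + 1 := by positivity
        exact (mul_lt_mul_iff_right₀ this).mpr (by linarith)
    calc 0 < volume U := hU.measure_pos _ hne
      _ = ballMeasure d U := by
        rw [ballMeasure, Measure.restrict_apply hU.measurableSet, Set.inter_eq_left.mpr]
        exact fun y hy => Metric.ball_subset_closedBall hy.1
      _ ≤ _ := measure_mono fun y hy =>
        have h : 0 < ballPow d k (x - y) := ih (by rw [← dist_eq_norm, dist_comm]; exact hy.2)
        h.ne.symm

/-! ### Fourier inversion: K_q and L_q as convolution powers. -/

/-- An integrable function that is continuous at the origin and has nonnegative Fourier transform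
has integrable Fourier transform. -/
theorem integrable_fourier_of_nonneg {V : Type*} [NormedAddCommGroup V] [InnerProductSpace ℝ V]
    [MeasurableSpace V] [BorelSpace V] [FiniteDimensional ℝ V] {f : V → ℂ} (hf : Integrable f)
    (hc : ContinuousAt f 0) (g : V → ℝ) (hg : ∀ ξ, 0 ≤ g ξ) (hfg : ∀ ξ, 𝓕 f ξ = g ξ) :
    Integrable (𝓕 f) := by
  have hcont : Continuous (𝓕 f) :=
    VectorFourier.fourierIntegral_continuous Real.continuous_fourierChar
      (L := innerₗ V) continuous_inner hf
  have hgcont : Continuous g := by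
    have : g = fun ξ => (𝓕 f ξ).re := by ext ξ; simp [hfg]
    rw [this]
    exact Complex.continuous_re.comp hcont
  have J : ∀ c : ℝ, 0 < c → Integrable (fun w : V => Complex.exp (- (c : ℂ)⁻¹ * ‖w‖ ^ 2)) := by
    intro c hc
    have := GaussianFourier.integrable_cexp_neg_mul_sq_norm_add (V := V) (b := (c : ℂ)⁻¹)
      (by simpa using hc) 0 (0 : V)
    simpa using this
  -- Transferring the Fourier transform from the Gaussian to f turns an approximate identity acting
  -- on f into a Gaussian-damped integral of 𝓕 f.
  have B : Tendsto (fun c : ℝ => ∫ w : V, Complex.exp (- (c : ℂ)⁻¹ * ‖w‖ ^ 2) • 𝓕 f w) atTop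
      (𝓝 (f 0)) := by
    refine (Real.tendsto_integral_gaussian_smul' hf hc).congr' ?_
    filter_upwards [Ioi_mem_atTop 0] with c (hc : 0 < c)
    have h1 : ∫ w : V, 𝓕 (fun w : V => Complex.exp (- (c : ℂ)⁻¹ * ‖w‖ ^ 2)) w • f w
        = ∫ w : V, Complex.exp (- (c : ℂ)⁻¹ * ‖w‖ ^ 2) • 𝓕 f w := by
      simpa using! (VectorFourier.integral_fourierIntegral_smul_eq_flip (L := innerₗ V)
        Real.continuous_fourierChar continuous_inner (J c hc) hf)
    rw [← h1]
    congr 1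
    ext w
    rw [fourier_gaussian_innerProductSpace (by simpa using hc)]
    congr 2
    · simp
    · congr 1
      simp
      ring
  have hseq : Tendsto (fun n : ℕ => (n : ℝ) + 1) atTop atTop :=
    tendsto_atTop_add_const_right _ _ tendsto_natCast_atTop_atTop
  have Bn := (B.comp hseq).norm
  set G : ℕ → V → ℝ := fun n w => Real.exp (- ((n : ℝ) + 1)⁻¹ * ‖w‖ ^ 2) * g w
  have hGn : ∀ n w, 0 ≤ G n w := fun n w => mul_nonneg (Real.exp_nonneg _) (hg w)
  have hGi : ∀ n, Integrable (G n) := by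
    intro n
    have hb := (J ((n : ℝ) + 1) (by positivity)).norm
    obtain ⟨C, hC⟩ : ∃ C, ∀ w, ‖g w‖ ≤ C := by
      refine ⟨∫ v, ‖f v‖, fun w => ?_⟩
      have := VectorFourier.norm_fourierIntegral_le_integral_norm Real.fourierChar volume
        (innerₗ V) f w
      have h2 : ‖g w‖ = ‖𝓕 f w‖ := by rw [hfg]; simp
      rw [h2]
      exact this
    have := hb.mul_bdd (f := fun w : V => ‖Complex.exp (- ((n + 1 : ℝ) : ℂ)⁻¹ * ‖w‖ ^ 2)‖)
      hgcont.aestronglyMeasurable (ae_of_all _ hC)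
    refine this.congr (ae_of_all _ fun w => ?_)
    simp only [G]
    congr 1
    rw [Complex.norm_exp]
    congr 1
    norm_cast
  have hGint : ∀ n : ℕ, ∫ w, G n w
      = ‖∫ w : V, Complex.exp (- (((n : ℝ) + 1 : ℝ) : ℂ)⁻¹ * ‖w‖ ^ 2) • 𝓕 f w‖ := by
    intro n
    have : ∫ w : V, Complex.exp (- (((n : ℝ) + 1 : ℝ) : ℂ)⁻¹ * ‖w‖ ^ 2) • 𝓕 f w
        = ((∫ w, G n w : ℝ) : ℂ) := by
      rw [← integral_complex_ofReal]
      congr 1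
      ext w
      rw [hfg]
      simp [G]
    rw [this, Complex.norm_real, Real.norm_of_nonneg (integral_nonneg (hGn n))]
  have hlim : Tendsto (fun n => ∫ w, G n w) atTop (𝓝 ‖f 0‖) := by
    refine Bn.congr fun n => ?_
    rw [hGint]
    rfl
  -- Fatou: the damping factors tend to 1, and nonnegativity of g makes the limit f 0 of the damped
  -- integrals bound the undamped one.
  have hfat : ∫⁻ w, ENNReal.ofReal (g w) ≤ ENNReal.ofReal ‖f 0‖ := by
    have hpt : ∀ w, Tendsto (fun n => ENNReal.ofReal (G n w)) atTop (𝓝 (ENNReal.ofReal (g w))) := by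
      intro w
      refine (ENNReal.continuous_ofReal.tendsto _).comp ?_
      have h0 : Tendsto (fun n : ℕ => Real.exp (- ((n : ℝ) + 1)⁻¹ * ‖w‖ ^ 2)) atTop (𝓝 1) := by
        have := ((tendsto_inv_atTop_zero.comp hseq).neg.mul_const (‖w‖ ^ 2))
        have := (Real.continuous_exp.tendsto _).comp this
        simpa using! this
      simpa only [one_mul] using! h0.mul_const (g w)
    calc ∫⁻ w, ENNReal.ofReal (g w)
        = ∫⁻ w, liminf (fun n => ENNReal.ofReal (G n w)) atTop := by
          congr 1; ext w; exact (hpt w).liminf_eq.symm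
      _ ≤ liminf (fun n => ∫⁻ w, ENNReal.ofReal (G n w)) atTop :=
          lintegral_liminf_le' fun n => (hGi n).aestronglyMeasurable.aemeasurable.ennreal_ofReal
      _ = liminf (fun n => ENNReal.ofReal (∫ w, G n w)) atTop := by
          congr 1; ext n
          rw [ofReal_integral_eq_lintegral_ofReal (hGi n) (ae_of_all _ (hGn n))]
      _ = ENNReal.ofReal ‖f 0‖ :=
          ((ENNReal.continuous_ofReal.tendsto _).comp hlim).liminf_eq
  have hgi : Integrable g := by
    refine ⟨hgcont.aestronglyMeasurable, ?_⟩
    rw [hasFiniteIntegral_iff_ofReal (ae_of_all _ hg)]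
    exact hfat.trans_lt ENNReal.ofReal_lt_top
  have : 𝓕 f = fun ξ => (g ξ : ℂ) := funext hfg
  rw [this]
  exact hgi.ofReal

theorem fourier_ballPow (d k : ℕ) (ξ : Rd d) :
    𝓕 (fun x => (ballPow d k x : ℂ)) ξ = ballHat d ξ ^ (k + 1) := by
  induction k with
  | zero =>
    rw [zero_add, pow_one, ballHat]
    have h : (fun x => (ballPow d 0 x : ℂ)) = (unitBall d).indicator fun _ => (1 : ℂ) := by
      ext x
      by_cases h : x ∈ unitBall d <;> simp [ballPow, h]
    rw [h]
  | succ k ih =>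
    have h0 : Integrable ((unitBall d).indicator fun _ => (1 : ℂ)) :=
      (integrable_indicator_iff (measurableSet_unitBall d)).mpr
        (integrableOn_const (measure_closedBall_lt_top).ne)
    have h := Real.fourier_mul_convolution_eq h0 (integrable_ballPow d k).ofReal ξ
    rw [pow_succ', ← ih]
    have h2 : (fun x => (ballPow d (k + 1) x : ℂ)) =
        ((unitBall d).indicator fun _ => (1 : ℂ)) ⋆[ContinuousLinearMap.mul ℂ ℂ]
          fun x => (ballPow d k x : ℂ) := by
      ext x
      rw [convolution_def, ballPow_succ, ballMeasure, ← integral_indicator (measurableSet_unitBall d),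
        ← integral_complex_ofReal]
      congr 1
      ext y
      by_cases h : y ∈ unitBall d <;> simp [h]
    rw [h2]
    exact h

/-- The square is nonnegative and is the transform of the continuous function `ballPow d 1`, so the
preceding criterion applies; every higher power is the square times a bounded factor. -/
theorem integrable_ballHat_pow (d k : ℕ) : Integrable fun ξ => ballHat d ξ ^ (k + 2) := by
  have hre : ∀ ξ, ballHat d ξ = ((ballHat d ξ).re : ℂ) := fun ξ =>
    (Complex.conj_eq_iff_re.mp (conj_ballHat d ξ)).symm
  have h2 : Integrable fun ξ => ballHat d ξ ^ 2 := by
    have := integrable_fourier_of_nonneg (f := fun x => (ballPow d 1 x : ℂ))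
      (integrable_ballPow d 1).ofReal
      (Complex.continuous_ofReal.comp (continuous_ballPow_succ d 0)).continuousAt
      (fun ξ => (ballHat d ξ).re ^ 2) (fun ξ => sq_nonneg _) (fun ξ => by
        rw [fourier_ballPow, hre ξ]; simp)
    refine this.congr (ae_of_all _ fun ξ => ?_)
    simp only [fourier_ballPow]
  have h0 : Integrable ((unitBall d).indicator fun _ => (1 : ℂ)) :=
    (integrable_indicator_iff (measurableSet_unitBall d)).mpr
      (integrableOn_const (measure_closedBall_lt_top).ne)
  have hcont : Continuous (ballHat d) :=
    VectorFourier.fourierIntegral_continuous Real.continuous_fourierChar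
      (L := innerₗ (Rd d)) continuous_inner h0
  obtain ⟨C, hC⟩ : ∃ C, ∀ ξ, ‖ballHat d ξ‖ ≤ C :=
    ⟨_, fun ξ => VectorFourier.norm_fourierIntegral_le_integral_norm Real.fourierChar volume
        (innerₗ (Rd d)) _ ξ⟩
  have := h2.bdd_mul (f := fun ξ => ballHat d ξ ^ k) (c := C ^ k)
    (hcont.pow k).aestronglyMeasurable (ae_of_all _ fun ξ => by
      rw [norm_pow]; exact pow_le_pow_left₀ (norm_nonneg _) (hC ξ) k)
  refine this.congr (ae_of_all _ fun ξ => ?_)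
  simp only [pow_add]

theorem fourierInv_ballHat_pow (d k : ℕ) (x : Rd d) :
    𝓕⁻ (fun ξ => ballHat d ξ ^ (k + 2)) x = ballPow d (k + 1) x := by
  have hF : 𝓕 (fun x => (ballPow d (k + 1) x : ℂ)) = fun ξ => ballHat d ξ ^ (k + 2) :=
    funext fun ξ => fourier_ballPow d (k + 1) ξ
  have := Continuous.fourierInv_fourier_eq
    (Complex.continuous_ofReal.comp (continuous_ballPow_succ d k))
    (integrable_ballPow d (k + 1)).ofReal (by
      have := integrable_ballHat_pow d k
      rw [← hF] at this
      exact this)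
  have h2 := congrFun this x
  rw [← hF]
  exact h2

/-- This is where the parity of q enters: an even power of a real number does not see its sign. -/
theorem norm_ballHat_rpow (d k : ℕ) (hk : Even k) (ξ : Rd d) :
    ((‖ballHat d ξ‖ ^ ((((k + 4 : ℕ)) : ℝ) - 2) : ℝ) : ℂ) = ballHat d ξ ^ (k + 2) := by
  have hre : ballHat d ξ = ((ballHat d ξ).re : ℂ) :=
    (Complex.conj_eq_iff_re.mp (conj_ballHat d ξ)).symm
  have h1 : (((k + 4 : ℕ)) : ℝ) - 2 = ((k + 2 : ℕ) : ℝ) := by push_cast; ring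
  rw [h1, Real.rpow_natCast, hre, Complex.norm_real, Real.norm_eq_abs,
    Even.pow_abs (hk.add even_two)]
  push_cast
  rfl

/-- For even `q` the function `L_q` is the `(q-2)`-fold convolution power of `1_𝔹`. -/
theorem L_eq_ballPow (d k : ℕ) (hk : Even k) (x : Rd d) :
    L d ((k + 4 : ℕ) : ℝ) x = ballPow d (k + 1) x := by
  have h := ofReal_L d ((k + 4 : ℕ) : ℝ) x
  have h2 : LHat d ((k + 4 : ℕ) : ℝ) = fun ξ => ballHat d ξ ^ (k + 2) :=
    funext fun ξ => norm_ballHat_rpow d k hk ξ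
  rw [h2, fourierInv_ballHat_pow] at h
  exact_mod_cast h

/-- For even `q` the function `K_q` is the `(q-1)`-fold convolution power of `1_𝔹`. -/
theorem K_eq_ballPow (d k : ℕ) (hk : Even k) (x : Rd d) :
    K d ((k + 4 : ℕ) : ℝ) x = ballPow d (k + 2) x := by
  have h := ofReal_K d ((k + 4 : ℕ) : ℝ) x
  have h2 : KHat d ((k + 4 : ℕ) : ℝ) = fun ξ => ballHat d ξ ^ (k + 1 + 2) :=
    funext fun ξ => by rw [KHat, norm_ballHat_rpow d k hk ξ]; ring
  rw [h2, fourierInv_ballHat_pow] at h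
  exact_mod_cast h

/-! ### Bounded functions and sums of independent points of the ball. -/

/-- Bounded measurable real-valued functions. -/
def BddMeas {α : Type*} [MeasurableSpace α] (F : α → ℝ) : Prop :=
  Measurable F ∧ ∃ C, ∀ x, ‖F x‖ ≤ C

namespace BddMeas

variable {α β : Type*} [MeasurableSpace α] [MeasurableSpace β] {F G : α → ℝ}

theorem const (c : ℝ) : BddMeas fun _ : α => c := ⟨measurable_const, ‖c‖, fun _ => le_rfl⟩

theorem add (hF : BddMeas F) (hG : BddMeas G) : BddMeas fun x => F x + G x := by
  obtain ⟨hF, C, hC⟩ := hF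
  obtain ⟨hG, D, hD⟩ := hG
  exact ⟨hF.add hG, C + D, fun x => (norm_add_le _ _).trans (add_le_add (hC x) (hD x))⟩

theorem mul (hF : BddMeas F) (hG : BddMeas G) : BddMeas fun x => F x * G x := by
  obtain ⟨hF, C, hC⟩ := hF
  obtain ⟨hG, D, hD⟩ := hG
  refine ⟨hF.mul hG, C * D, fun x => ?_⟩
  rw [norm_mul]
  exact mul_le_mul (hC x) (hD x) (norm_nonneg _) ((norm_nonneg _).trans (hC x))

theorem sub (hF : BddMeas F) (hG : BddMeas G) : BddMeas fun x => F x - G x := by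
  simpa [sub_eq_add_neg] using hF.add ((const (-1)).mul hG)

theorem pow (hF : BddMeas F) (n : ℕ) : BddMeas fun x => F x ^ n := by
  induction n with
  | zero => simpa using const 1
  | succ n ih => simpa [pow_succ] using ih.mul hF

theorem comp (hF : BddMeas F) {φ : β → α} (hφ : Measurable φ) : BddMeas fun x => F (φ x) :=
  ⟨hF.1.comp hφ, hF.2.imp fun _ hC _ => hC _⟩

theorem sum {ι : Type*} (s : Finset ι) {F : ι → α → ℝ} (hF : ∀ i, BddMeas (F i)) :
    BddMeas fun x => ∑ i ∈ s, F i x := by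
  classical
  induction s using Finset.induction_on with
  | empty => simpa using const 0
  | insert i s hi ih => simpa [Finset.sum_insert hi] using (hF i).add ih

theorem integrable (hF : BddMeas F) (μ : Measure α) [IsFiniteMeasure μ] : Integrable F μ := by
  obtain ⟨hF, C, hC⟩ := hF
  exact Integrable.of_bound hF.aestronglyMeasurable C (ae_of_all _ hC)

theorem memLp (hF : BddMeas F) (p : ENNReal) (μ : Measure α) [IsFiniteMeasure μ] :
    MemLp F p μ := by
  obtain ⟨hF, C, hC⟩ := hF
  exact MemLp.of_bound hF.aestronglyMeasurable C (ae_of_all _ hC)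

end BddMeas

theorem bddMeas_ballPow (d k : ℕ) : BddMeas (ballPow d k) :=
  ⟨measurable_ballPow d k, (exists_ballPow_le d k).imp fun C hC x => by
    rw [Real.norm_of_nonneg (ballPow_nonneg d k x)]; exact hC x⟩

/-- The product of `k` copies of Lebesgue measure on the ball. -/
abbrev ballPi (d k : ℕ) : Measure (Fin k → Rd d) := Measure.pi fun _ => ballMeasure d

theorem integral_ballPi_succ {d k : ℕ} (i : Fin (k + 1)) {Φ : (Fin (k + 1) → Rd d) → ℝ}
    (hΦ : BddMeas Φ) :
    ∫ x, Φ x ∂ballPi d (k + 1)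
      = ∫ x, ∫ y, Φ (i.insertNth x y) ∂ballPi d k ∂ballMeasure d := by
  have h := (measurePreserving_piFinSuccAbove (fun _ : Fin (k + 1) => ballMeasure d) i).symm
  have h2 := h.integral_comp' Φ
  rw [← h2]
  have hb : BddMeas fun p : Rd d × (Fin k → Rd d) =>
      Φ ((MeasurableEquiv.piFinSuccAbove (fun _ => Rd d) i).symm p) :=
    hΦ.comp (MeasurableEquiv.measurable _)
  exact integral_prod _ (hb.integrable _)

theorem bddMeas_comp_sum {d k : ℕ} {G : Rd d → ℝ} (hG : BddMeas G) :
    BddMeas fun x : Fin k → Rd d => G (∑ i, x i) :=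
  hG.comp (Finset.measurable_sum _ fun i _ => measurable_pi_apply i)

theorem integral_ballMeasure (d : ℕ) (F : Rd d → ℝ) :
    ∫ x, F x ∂ballMeasure d = ∫ x, ballPow d 0 x * F x := by
  rw [ballMeasure, ← integral_indicator (measurableSet_unitBall d)]
  congr 1
  ext x
  by_cases h : x ∈ unitBall d <;> simp [ballPow, h]

/-- The law of the sum of `k + 1` independent points of the ball has density `ballPow d k`. -/
theorem integral_comp_sum_ballPi (d k : ℕ) {G : Rd d → ℝ} (hG : BddMeas G) :
    ∫ x, G (∑ i, x i) ∂ballPi d (k + 1) = ∫ z, ballPow d k z * G z := by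
  induction k generalizing G with
  | zero =>
    rw [integral_ballPi_succ 0 (bddMeas_comp_sum hG), ← integral_ballMeasure]
    congr 1
    ext x
    simp [measureReal_def]
  | succ k ih =>
    rw [integral_ballPi_succ 0 (bddMeas_comp_sum hG)]
    have h1 : ∀ x : Rd d, ∫ y, G (∑ i, (0 : Fin (k + 2)).insertNth (α := fun _ => Rd d) x y i)
        ∂ballPi d (k + 1) = ∫ z, ballPow d k (z - x) * G z := by
      intro x
      have := ih (G := fun z => G (x + z)) (hG.comp (measurable_const.add measurable_id))
      have h3 : ∀ y : Fin (k + 1) → Rd d,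
          ∑ i, (0 : Fin (k + 2)).insertNth (α := fun _ => Rd d) x y i = x + ∑ i, y i := by
        intro y
        rw [Fin.sum_univ_succAbove _ 0]
        simp
      simp only [h3]
      rw [this, ← integral_add_left_eq_self (fun z => ballPow d k (z - x) * G z) x]
      simp
    simp only [h1]
    rw [integral_integral_swap]
    · congr 1
      ext z
      rw [integral_mul_const, ballPow_succ]
    · obtain ⟨hGm, C, hC⟩ := hG
      have hi : Integrable (fun p : Rd d × Rd d => (1 : ℝ) * ballPow d k p.2)
          ((ballMeasure d).prod volume) :=
        (integrable_const (1 : ℝ)).mul_prod (integrable_ballPow d k)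
      -- The shear (x, z) ↦ (x, z - x) preserves the product measure, which reduces the
      -- integrability needed for Fubini to a product function.
      have hmp : MeasurePreserving (fun p : Rd d × Rd d => (p.1, p.2 - p.1))
          ((ballMeasure d).prod volume) ((ballMeasure d).prod volume) :=
        MeasurePreserving.skew_product (f := id) (g := fun x z => z - x) (MeasurePreserving.id _)
          (measurable_snd.sub measurable_fst) (ae_of_all _ fun x =>
            (measurePreserving_sub_right volume x).map_eq)
      have hi2 := hmp.integrable_comp_of_integrable hi
      refine Integrable.mul_bdd (c := C) ?_ (hGm.comp measurable_snd).aestronglyMeasurable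
        (ae_of_all _ fun p => hC _)
      simpa [Function.comp_def] using hi2

theorem integral_comp_add_sum_ballPi (d k : ℕ) {G : Rd d → ℝ} (hG : BddMeas G) (x : Rd d) :
    ∫ y, G (x + ∑ i, y i) ∂ballPi d (k + 1) = ∫ z, ballPow d k (z - x) * G z := by
  rw [integral_comp_sum_ballPi d k (G := fun z => G (x + z))
    (hG.comp (measurable_const.add measurable_id)),
    ← integral_add_left_eq_self (fun z => ballPow d k (z - x) * G z) x]
  simp

/-- Singling out one point leaves the sum of the k+1 others, whose law has density `ballPow d k`. -/
theorem integral_mul_comp_sum_ballPi (d k : ℕ) (i : Fin (k + 2)) {F G : Rd d → ℝ}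
    (hF : BddMeas F) (hG : BddMeas G) :
    ∫ x, F (x i) * G (∑ j, x j) ∂ballPi d (k + 2)
      = ∫ x, F x * (∫ z, ballPow d k (z - x) * G z) ∂ballMeasure d := by
  rw [integral_ballPi_succ i ((hF.comp (measurable_pi_apply i)).mul (bddMeas_comp_sum hG))]
  congr 1
  ext x
  rw [← integral_comp_add_sum_ballPi d k hG, ← integral_const_mul]
  congr 1
  ext y
  rw [Fin.sum_univ_succAbove _ i]
  simp

theorem integral_mul_mul_comp_sum_ballPi (d k : ℕ) (i : Fin (k + 3)) (j : Fin (k + 2))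
    {F F' G : Rd d → ℝ} (hF : BddMeas F) (hF' : BddMeas F') (hG : BddMeas G) :
    ∫ x, F (x i) * F' (x (i.succAbove j)) * G (∑ j, x j) ∂ballPi d (k + 3)
      = ∫ x, ∫ y, F x * F' y * (∫ z, ballPow d k (z - (x + y)) * G z)
        ∂ballMeasure d ∂ballMeasure d := by
  have h0 : BddMeas fun x : Fin (k + 3) → Rd d =>
      F (x i) * F' (x (i.succAbove j)) * G (∑ j, x j) :=
    ((hF.comp (measurable_pi_apply i)).mul (hF'.comp (measurable_pi_apply (i.succAbove j)))).mul
      (bddMeas_comp_sum hG)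
  rw [integral_ballPi_succ i h0]
  congr 1
  ext x
  have h1 : ∀ y : Fin (k + 2) → Rd d, F (i.insertNth (α := fun _ => Rd d) x y i)
      * F' (i.insertNth (α := fun _ => Rd d) x y (i.succAbove j))
      * G (∑ j, i.insertNth (α := fun _ => Rd d) x y j)
      = (F x * F' (y j)) * G (x + ∑ j, y j) := by
    intro y
    rw [Fin.sum_univ_succAbove _ i]
    simp
  simp only [h1]
  have h2 : BddMeas fun y : Fin (k + 2) → Rd d => (F x * F' (y j)) * G (x + ∑ j, y j) :=
    ((BddMeas.const _).mul (hF'.comp (measurable_pi_apply j))).mul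
      (bddMeas_comp_sum (G := fun z => G (x + z)) (hG.comp (measurable_const.add measurable_id)))
  rw [integral_ballPi_succ j h2]
  congr 1
  ext y
  rw [← integral_comp_add_sum_ballPi d k hG, ← integral_const_mul]
  congr 1
  ext w
  rw [Fin.sum_univ_succAbove _ j]
  simp [add_assoc]

/-! ### The two sum-of-squares identities. -/

/-- `∫_𝔹 f² 1_𝔹^{*(k+1)}`. -/
def weightedSq (d k : ℕ) (f : Rd d → ℝ) : ℝ := ∫ x, f x ^ 2 * ballPow d k x ∂ballMeasure d

/-- `∫_𝔹 ∫_𝔹 f(x) f(y) 1_𝔹^{*(k+1)}(x - y)`. -/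
def convForm (d k : ℕ) (f : Rd d → ℝ) : ℝ :=
  ∫ x, ∫ y, f x * f y * ballPow d k (x - y) ∂ballMeasure d ∂ballMeasure d

theorem ballPow_sub_comm (d k : ℕ) (x y : Rd d) : ballPow d k (x - y) = ballPow d k (y - x) := by
  rw [← ballPow_neg, neg_sub]

theorem integral_neg_ballMeasure (d : ℕ) (F : Rd d → ℝ) :
    ∫ y, F (-y) ∂ballMeasure d = ∫ y, F y ∂ballMeasure d :=
  (measurePreserving_neg_ball d).integral_comp (MeasurableEquiv.neg (Rd d)).measurableEmbedding F

theorem integral_ballPow_sub_mul (d k : ℕ) (F : Rd d → ℝ) (x : Rd d) :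
    ∫ z, ballPow d k (z - x) * (ballPow d 0 z * F z)
      = ∫ y, F y * ballPow d k (x - y) ∂ballMeasure d := by
  rw [integral_ballMeasure]
  congr 1
  ext z
  rw [ballPow_sub_comm]
  ring

theorem integral_ballPow_sub_mul_ballPow_zero (d k : ℕ) (x : Rd d) :
    ∫ z, ballPow d k (z - x) * ballPow d 0 z = ballPow d (k + 1) x := by
  have := integral_ballPow_sub_mul d k (fun _ => 1) x
  simpa [ballPow_succ] using this

theorem bddMeas_prod_mul_ballPow_sub (d k : ℕ) {F : Rd d × Rd d → ℝ} (hF : BddMeas F) :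
    BddMeas fun p : Rd d × Rd d => F p * ballPow d k (p.1 - p.2) :=
  hF.mul ((bddMeas_ballPow d k).comp (measurable_fst.sub measurable_snd))

/-- The form of `I - T` as a sum of squares. -/
theorem integral_sub_sq (d k : ℕ) {f : Rd d → ℝ} (hf : BddMeas f) :
    ∫ x, ∫ y, (f x - f y) ^ 2 * ballPow d k (x - y) ∂ballMeasure d ∂ballMeasure d
      = 2 * weightedSq d (k + 1) f - 2 * convForm d k f := by
  have b1 := bddMeas_prod_mul_ballPow_sub d k ((hf.comp measurable_fst).pow 2)
  have b2 := bddMeas_prod_mul_ballPow_sub d k ((hf.comp measurable_snd).pow 2)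
  have b3 := bddMeas_prod_mul_ballPow_sub d k
    ((hf.comp measurable_fst).mul (hf.comp measurable_snd))
  -- Integrating out one variable over the ball raises the convolution power by one; this is K_q =
  -- 1_𝔹 * L_q when the kernel is L_q.
  have h1 : ∫ x, ∫ y, f x ^ 2 * ballPow d k (x - y) ∂ballMeasure d ∂ballMeasure d
      = weightedSq d (k + 1) f := by
    simp only [integral_const_mul, ← ballPow_succ, weightedSq]
  have h2 : ∫ x, ∫ y, f y ^ 2 * ballPow d k (x - y) ∂ballMeasure d ∂ballMeasure d
      = weightedSq d (k + 1) f := by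
    rw [integral_integral_swap (b2.integrable _), ← h1]
    simp only [fun x y : Rd d => ballPow_sub_comm d k x y]
  have e : ∀ x y, (f x - f y) ^ 2 * ballPow d k (x - y)
      = f x ^ 2 * ballPow d k (x - y) + f y ^ 2 * ballPow d k (x - y)
        - 2 * (f x * f y * ballPow d k (x - y)) := fun x y => by ring
  have i12 := ((b1.add b2).integrable ((ballMeasure d).prod (ballMeasure d)))
  have i1 := (b1.integrable ((ballMeasure d).prod (ballMeasure d)))
  have i2 := (b2.integrable ((ballMeasure d).prod (ballMeasure d)))
  have i3 := (b3.integrable ((ballMeasure d).prod (ballMeasure d)))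
  have hp := integral_prod (fun p : Rd d × Rd d =>
    (f p.1 - f p.2) ^ 2 * ballPow d k (p.1 - p.2)) ((i12.sub (i3.const_mul 2)).congr
      (ae_of_all _ fun p => (e p.1 p.2).symm))
  rw [← hp]
  simp only [e]
  rw [integral_sub i12 (i3.const_mul 2), integral_add i1 i2, integral_const_mul,
    integral_prod _ i1, integral_prod _ i2, integral_prod _ i3, h1, h2, convForm]
  ring

/-- The form of `I - (q-1) T` on odd functions as a sum of squares. -/
theorem integral_sum_sub_sq (d k : ℕ) {f : Rd d → ℝ} (hf : BddMeas f) (hodd : ∀ x, f (-x) = -f x) :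
    ∫ x, (∑ i, f (x i) - f (∑ i, x i)) ^ 2 * ballPow d 0 (∑ i, x i) ∂ballPi d (k + 3)
      = (k + 4) * (weightedSq d (k + 2) f - (k + 3) * convForm d (k + 1) f) := by
  have hu := bddMeas_ballPow d 0
  have hfi : ∀ i : Fin (k + 3), BddMeas fun x : Fin (k + 3) → Rd d => f (x i) :=
    fun i => hf.comp (measurable_pi_apply i)
  have v1 : ∫ x, ballPow d 0 (∑ i, x i) * f (∑ i, x i) ^ 2 ∂ballPi d (k + 3)
      = weightedSq d (k + 2) f := by
    rw [integral_comp_sum_ballPi d (k + 2) (G := fun z => ballPow d 0 z * f z ^ 2)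
      (hu.mul (hf.pow 2)), weightedSq, integral_ballMeasure]
    congr 1
    ext z
    ring
  have v2 : ∀ i, ∫ x, f (x i) * (ballPow d 0 (∑ i, x i) * f (∑ i, x i)) ∂ballPi d (k + 3)
      = convForm d (k + 1) f := by
    intro i
    rw [integral_mul_comp_sum_ballPi d (k + 1) i (F := f) (G := fun z => ballPow d 0 z * f z) hf
      (hu.mul hf), convForm]
    congr 1
    ext x
    rw [integral_ballPow_sub_mul, ← integral_const_mul]
    simp only [mul_assoc]
  have v3 : ∀ i, ∫ x, f (x i) ^ 2 * ballPow d 0 (∑ i, x i) ∂ballPi d (k + 3)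
      = weightedSq d (k + 2) f := by
    intro i
    rw [integral_mul_comp_sum_ballPi d (k + 1) i (F := fun z => f z ^ 2) (G := ballPow d 0)
      (hf.pow 2) hu, weightedSq]
    simp only [integral_ballPow_sub_mul_ballPow_zero]
  -- Two distinct points produce the kernel at x + y; the substitution y ↦ -y restores x - y, and
  -- oddness of f supplies the minus sign.
  have v4 : ∀ (i : Fin (k + 3)) (j : Fin (k + 2)),
      ∫ x, f (x i) * f (x (i.succAbove j)) * ballPow d 0 (∑ i, x i) ∂ballPi d (k + 3)
      = - convForm d (k + 1) f := by
    intro i j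
    rw [integral_mul_mul_comp_sum_ballPi d k i j hf hf hu, convForm, ← integral_neg]
    congr 1
    ext x
    rw [← integral_neg_ballMeasure, ← integral_neg]
    congr 1
    ext y
    rw [integral_ballPow_sub_mul_ballPow_zero, hodd, ← sub_eq_add_neg]
    ring
  have e : ∀ x : Fin (k + 3) → Rd d,
      (∑ i, f (x i) - f (∑ i, x i)) ^ 2 * ballPow d 0 (∑ i, x i)
      = (∑ i, (f (x i) ^ 2 * ballPow d 0 (∑ i, x i)
          + ∑ j : Fin (k + 2), f (x i) * f (x (i.succAbove j)) * ballPow d 0 (∑ i, x i)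
          - 2 * (f (x i) * (ballPow d 0 (∑ i, x i) * f (∑ i, x i)))))
        + ballPow d 0 (∑ i, x i) * f (∑ i, x i) ^ 2 := by
    intro x
    have h : ∀ i, f (x i) * ∑ j, f (x j)
        = f (x i) ^ 2 + ∑ j : Fin (k + 2), f (x i) * f (x (i.succAbove j)) := by
      intro i
      rw [Fin.sum_univ_succAbove _ i, mul_add, Finset.mul_sum, sq]
    have h2 : (∑ i, f (x i)) ^ 2
        = ∑ i, (f (x i) ^ 2 + ∑ j : Fin (k + 2), f (x i) * f (x (i.succAbove j))) := by
      rw [sq, Finset.sum_mul]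
      exact Finset.sum_congr rfl fun i _ => h i
    rw [sub_sq, h2, Finset.mul_sum, Finset.sum_mul, add_mul, sub_mul, Finset.sum_mul,
      Finset.sum_mul, ← Finset.sum_sub_distrib]
    congr 1
    · refine Finset.sum_congr rfl fun i _ => ?_
      rw [add_mul, Finset.sum_mul]
      ring
    · ring
  have huS := bddMeas_comp_sum (k := k + 3) hu
  have b1 := bddMeas_comp_sum (k := k + 3) (hu.mul (hf.pow 2))
  have b2 := fun i => (hfi i).mul (bddMeas_comp_sum (k := k + 3) (hu.mul hf))
  have b3 := fun i => ((hfi i).pow 2).mul huS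
  have b4 := fun (i : Fin (k + 3)) (j : Fin (k + 2)) =>
    ((hfi i).mul (hfi (i.succAbove j))).mul huS
  have bi := fun i => ((b3 i).add (BddMeas.sum Finset.univ (b4 i))).sub
    ((BddMeas.const 2).mul (b2 i))
  simp only [e]
  rw [integral_add ((BddMeas.sum Finset.univ bi).integrable _) (b1.integrable _),
    integral_finsetSum _ (fun i _ => (bi i).integrable _), v1]
  -- Each of the k+3 indices contributes one square, k+2 products with other points and a doubled
  -- product with the sum, so the coefficient of `convForm` is -(k+2) - 2.
  have hi : ∀ i : Fin (k + 3), ∫ x : Fin (k + 3) → Rd d, (f (x i) ^ 2 * ballPow d 0 (∑ i, x i)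
          + ∑ j : Fin (k + 2), f (x i) * f (x (i.succAbove j)) * ballPow d 0 (∑ i, x i)
          - 2 * (f (x i) * (ballPow d 0 (∑ i, x i) * f (∑ i, x i)))) ∂ballPi d (k + 3)
      = weightedSq d (k + 2) f - (k + 4) * convForm d (k + 1) f := by
    intro i
    rw [integral_sub (((b3 i).add (BddMeas.sum Finset.univ (b4 i))).integrable _)
      (((BddMeas.const 2).mul (b2 i)).integrable _),
      integral_add ((b3 i).integrable _) ((BddMeas.sum Finset.univ (b4 i)).integrable _),
      integral_finsetSum _ (fun j _ => (b4 i j).integrable _), integral_const_mul, v3, v2]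
    simp only [v4, Finset.sum_const, Finset.card_univ, Fintype.card_fin, nsmul_eq_mul]
    push_cast
    ring
  simp only [hi, Finset.sum_const, Finset.card_univ, Fintype.card_fin, nsmul_eq_mul]
  push_cast
  ring

/-! ### Spectral gap for compact operators, and compactness of kernel operators. -/

section Operator

variable {E : Type*} [NormedAddCommGroup E] [InnerProductSpace ℝ E]

/-- The Cauchy–Schwarz inequality for a positive semidefinite form. -/
theorem norm_sq_le_of_nonneg (M : E →L[ℝ] E) (hsymm : ∀ x y, inner ℝ x (M y) = inner ℝ (M x) y)
    (hpos : ∀ x, 0 ≤ inner ℝ x (M x)) (x : E) :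
    ‖M x‖ ^ 2 ≤ (‖M‖ + 1) * inner ℝ x (M x) := by
  have hm : 0 < ‖M‖ + 1 := by positivity
  set m := ‖M‖ + 1 with hmdef
  -- Expanding positivity at mx - Mx gives m²⟨x, Mx⟩ - 2m‖Mx‖² + ⟨Mx, M²x⟩ ≥ 0, and the last term is
  -- at most m‖Mx‖². The 1 added to the norm keeps m positive when M = 0.
  have h := hpos (m • x - M x)
  have h2 : inner ℝ (M x) (M (M x)) ≤ m * ‖M x‖ ^ 2 := by
    calc inner ℝ (M x) (M (M x)) ≤ ‖M x‖ * ‖M (M x)‖ := real_inner_le_norm _ _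
      _ ≤ ‖M x‖ * (m * ‖M x‖) := by
        gcongr
        exact (M.le_opNorm _).trans (by gcongr; linarith)
      _ = _ := by ring
  simp only [map_sub, map_smul, inner_sub_left, inner_sub_right, inner_smul_left,
    inner_smul_right, hsymm x (M x), real_inner_self_eq_norm_sq, conj_trivial] at h
  have h3 : 0 ≤ m * (m * inner ℝ x (M x) - ‖M x‖ ^ 2) := by nlinarith
  have := nonneg_of_mul_nonneg_right h3 hm
  linarith

/-- If `C` is compact, self-adjoint, and `1 - C` is positive semidefinite with kernel `H`, then
`1 - C` is bounded below on the orthogonal complement of `H`. -/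
theorem exists_gap_of_isCompactOperator [CompleteSpace E] {C : E →L[ℝ] E} (hC : IsCompactOperator C)
    (hsymm : ∀ x y, inner ℝ x (C y) = inner ℝ (C x) y)
    (hpos : ∀ x, 0 ≤ inner ℝ x (x - C x)) (H : Submodule ℝ E) [H.HasOrthogonalProjection]
    (hker : ∀ x, x ∈ H ↔ C x = x) :
    ∃ c : ℝ, 0 < c ∧ ∀ x, c * ‖x - H.starProjection x‖ ^ 2 ≤ inner ℝ x (x - C x) := by
  have hperp : ∀ x ∈ Hᗮ, C x ∈ Hᗮ := by
    intro x hx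
    rw [Submodule.mem_orthogonal] at hx ⊢
    intro u hu
    rw [hsymm, (hker u).mp hu]
    exact hx u hu
  have hPperp : ∀ x, x - H.starProjection x ∈ Hᗮ := fun x =>
    Submodule.sub_starProjection_mem_orthogonal x
  set S : E →L[ℝ] E := C ∘L (1 - H.starProjection)
  have hS : IsCompactOperator S := hC.comp_clm _
  -- A fixed vector of S lies in `Hᗮ`, where S agrees with C; it is then fixed by C, hence also lies
  -- in H and vanishes.
  have hne : ¬ Module.End.HasEigenvalue (S : Module.End ℝ E) 1 := by
    intro h
    obtain ⟨x, hx⟩ := h.exists_hasEigenvector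
    have h1 : C (x - H.starProjection x) = x := by simpa [S] using hx.apply_eq_smul
    have h2 : x ∈ Hᗮ := h1 ▸ hperp _ (hPperp x)
    have h3 : H.starProjection x = 0 := (Submodule.starProjection_apply_eq_zero_iff H).mpr h2
    rw [h3, sub_zero] at h1
    have h4 : x ∈ H := (hker x).mpr h1
    exact hx.2 (by simpa using Submodule.inner_right_of_mem_orthogonal h4 h2)
  -- Fredholm alternative: as 1 is not an eigenvalue of the compact operator S, S - 1 is bounded
  -- below.
  obtain ⟨κ, hκ⟩ := hS.antilipschitz_of_not_hasEigenvalue one_ne_zero hne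
  obtain ⟨b, hb, hbound⟩ := antilipschitzWith_iff_exists_mul_le_norm.mp ⟨κ, hκ⟩
  have hM := norm_sq_le_of_nonneg (1 - C) (fun x y => by
    simp [inner_sub_left, inner_sub_right, hsymm]) (fun x => by simpa using hpos x)
  have hm : 0 < ‖(1 : E →L[ℝ] E) - C‖ + 1 := by positivity
  set m := ‖(1 : E →L[ℝ] E) - C‖ + 1
  refine ⟨b ^ 2 / m, by positivity, fun x => ?_⟩
  set y := x - H.starProjection x with hy
  have hyP : H.starProjection y = 0 := (Submodule.starProjection_apply_eq_zero_iff H).mpr (hPperp x)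
  have hCP : C (H.starProjection x) = H.starProjection x :=
    (hker _).mp (Submodule.starProjection_apply_mem H x)
  -- The component of x in H is killed by 1 - C, so by symmetry it does not contribute to the form.
  have hxy : inner ℝ x (x - C x) = inner ℝ y (y - C y) := by
    have h1 : x - C x = y - C y := by rw [hy, map_sub, hCP]; abel
    have h2 : inner ℝ (H.starProjection x) (y - C y) = 0 := by
      rw [inner_sub_right, hsymm, hCP, sub_self]
    rw [h1]
    nth_rewrite 1 [show x = y + H.starProjection x by rw [hy]; abel]
    rw [inner_add_left, h2, add_zero]
  have h1 := hbound y
  have h2 : ‖(S - (1 : ℝ) • (1 : E →L[ℝ] E)) y‖ = ‖(1 - C) y‖ := by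
    rw [← norm_neg]
    simp [S, hyP]
  rw [h2] at h1
  rw [hxy, div_mul_eq_mul_div, div_le_iff₀ hm]
  calc b ^ 2 * ‖y‖ ^ 2 = (b * ‖y‖) ^ 2 := by ring
    _ ≤ ‖(1 - C) y‖ ^ 2 := by gcongr
    _ ≤ m * inner ℝ y ((1 - C) y) := hM y
    _ = _ := by simp [mul_comm]

variable {X : Type*} [MeasurableSpace X] {μ : Measure X}

/-- The operator `h ↦ (x ↦ ⟨h, κ(x)⟩)` with square-integrable vector-valued kernel `κ`,
as a bounded bilinear map of `κ` and `h`. -/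
def kernelOp (E : Type*) [NormedAddCommGroup E] [InnerProductSpace ℝ E] (μ : Measure X) :
    Lp E 2 μ →L[ℝ] E →L[ℝ] Lp ℝ 2 μ :=
  LinearMap.mkContinuous₂
    (LinearMap.mk₂ ℝ (fun κ h => (innerSL ℝ h).compLp κ)
      (fun κ κ' h => ((innerSL ℝ h).compLpₗ 2 μ).map_add κ κ')
      (fun c κ h => ((innerSL ℝ h).compLpₗ 2 μ).map_smul c κ)
      (fun κ h h' => by rw [map_add, ContinuousLinearMap.add_compLp])
      (fun c κ h => by rw [map_smul, ContinuousLinearMap.smul_compLp])) 1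
    (fun κ h => by
      have := (innerSL ℝ h).norm_compLp_le κ
      rw [innerSL_apply_norm, mul_comm] at this
      rw [one_mul]
      exact this)

theorem kernelOp_apply (κ : Lp E 2 μ) (h : E) :
    kernelOp E μ κ h =ᵐ[μ] fun x => inner ℝ h (κ x) :=
  (innerSL ℝ h).coeFn_compLp' κ

/-- An indicator kernel gives an operator of rank at most one. Sums of such kernels are dense in L²,
the operator depends continuously on its kernel, and compact operators form a closed set. -/
theorem isCompactOperator_kernelOp (κ : Lp E 2 μ) :
    IsCompactOperator (kernelOp E μ κ) := by
  induction κ using Lp.induction (p := 2) (μ := μ) (E := E) ENNReal.ofNat_ne_top with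
  | @indicatorConst c s hs hμs =>
    rw [Lp.simpleFunc.coe_indicatorConst]
    have h : kernelOp E μ (indicatorConstLp 2 hs hμs.ne c)
        = (ContinuousLinearMap.toSpanSingleton ℝ (indicatorConstLp 2 hs hμs.ne (1 : ℝ))) ∘L
            innerSL ℝ c := by
      ext1 h
      refine Lp.ext ?_
      have h1 : ((ContinuousLinearMap.toSpanSingleton ℝ (indicatorConstLp 2 hs hμs.ne (1 : ℝ))) ∘L
            innerSL ℝ c) h = (inner ℝ c h : ℝ) • indicatorConstLp 2 hs hμs.ne (1 : ℝ) := rfl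
      rw [h1]
      filter_upwards [kernelOp_apply (indicatorConstLp 2 hs hμs.ne c) h,
        indicatorConstLp_coeFn (p := 2) (hs := hs) (hμs := hμs.ne) (c := c),
        indicatorConstLp_coeFn (p := 2) (hs := hs) (hμs := hμs.ne) (c := (1 : ℝ)),
        Lp.coeFn_smul (inner ℝ c h : ℝ) (indicatorConstLp 2 hs hμs.ne (1 : ℝ))] with x h1 h2 h3 h4
      rw [h1, h4, Pi.smul_apply, h2, h3, real_inner_comm]
      by_cases hx : x ∈ s <;> simp [hx]
    rw [h]
    exact (isCompactOperator_of_locallyCompactSpace_dom (innerSL ℝ c)).clm_comp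
      (ContinuousLinearMap.toSpanSingleton ℝ (indicatorConstLp 2 hs hμs.ne (1 : ℝ)))
  | add hf hg _ h1 h2 => rw [map_add]; exact h1.add h2
  | isClosed =>
    exact isClosed_setOfPred_isCompactOperator.preimage (kernelOp E μ).continuous

end Operator

/-! ### Local additivity implies linearity. -/

section Additive

variable {E : Type*} [NormedAddCommGroup E] [InnerProductSpace ℝ E] [CompleteSpace E]

/-- A function that is additive on the open unit ball and continuous at the origin is linear on the
ball. -/
theorem exists_eq_inner_of_add {f : E → ℝ} (hc : ContinuousAt f 0)
    (hadd : ∀ x y, ‖x‖ < 1 → ‖y‖ < 1 → ‖x + y‖ < 1 → f (x + y) = f x + f y) :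
    ∃ a : E, ∀ x, ‖x‖ < 1 → f x = inner ℝ a x := by
  have h0 : f 0 = 0 := by
    have := hadd 0 0 (by simp) (by simp) (by simp)
    simpa using this
  have hmul : ∀ (n : ℕ) (x : E), ‖(n : ℝ) • x‖ < 1 → f ((n : ℝ) • x) = n * f x := by
    intro n
    induction n with
    | zero => intro x _; simp [h0]
    | succ n ih =>
      intro x hx
      rw [norm_smul, Real.norm_natCast] at hx
      push_cast at hx
      have hn : 0 ≤ (n : ℝ) * ‖x‖ := by positivity
      have hx1 : ‖x‖ < 1 := by nlinarith
      have hx2 : ‖(n : ℝ) • x‖ < 1 := by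
        rw [norm_smul, Real.norm_natCast]
        nlinarith [norm_nonneg x]
      have e : ((n + 1 : ℕ) : ℝ) • x = (n : ℝ) • x + x := by
        push_cast; rw [add_smul, one_smul]
      rw [e, hadd _ _ hx2 hx1 (by
        rw [← e, norm_smul, Real.norm_natCast]; push_cast; exact hx), ih x hx2]
      push_cast
      ring
  have hlt : ∀ (n : ℕ) (x : E), ‖x‖ < n → ‖(n : ℝ)⁻¹ • x‖ < 1 := by
    intro n x hx
    have : 0 < (n : ℝ) := (norm_nonneg x).trans_lt hx
    rw [norm_smul, norm_inv, Real.norm_natCast, inv_mul_lt_iff₀ this]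
    linarith
  -- Both sides are compared through the common subdivision x/(nm).
  have hindep : ∀ (n m : ℕ) (x : E), ‖x‖ < n → ‖x‖ < m →
      n * f ((n : ℝ)⁻¹ • x) = m * f ((m : ℝ)⁻¹ • x) := by
    intro n m x hn hm
    have hn0 : (n : ℝ) ≠ 0 := ((norm_nonneg x).trans_lt hn).ne'
    have hm0 : (m : ℝ) ≠ 0 := ((norm_nonneg x).trans_lt hm).ne'
    have e1 : (n : ℝ)⁻¹ • x = (m : ℝ) • ((n : ℝ)⁻¹ • (m : ℝ)⁻¹ • x) := by
      rw [smul_smul, smul_smul]; congr 1; field_simp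
    have e2 : (m : ℝ)⁻¹ • x = (n : ℝ) • ((n : ℝ)⁻¹ • (m : ℝ)⁻¹ • x) := by
      rw [smul_smul, smul_smul]; congr 1; field_simp
    have h1 := hmul m ((n : ℝ)⁻¹ • (m : ℝ)⁻¹ • x) (by rw [← e1]; exact hlt n x hn)
    have h2 := hmul n ((n : ℝ)⁻¹ • (m : ℝ)⁻¹ • x) (by rw [← e2]; exact hlt m x hm)
    rw [← e1] at h1
    rw [← e2] at h2
    rw [h1, h2]
    ring
  -- Any integer exceeding ‖x‖ would serve in n f(x/n); this choice makes the extension of f to the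
  -- whole space a function, and additivity is checked at one scale n > ‖x‖ + ‖y‖.
  set N : E → ℕ := fun x => ⌊‖x‖⌋₊ + 1
  have hN : ∀ x, ‖x‖ < N x := fun x => by
    simpa [N] using Nat.lt_floor_add_one ‖x‖
  have hF : ∀ (n : ℕ) (x : E), ‖x‖ < n → N x * f ((N x : ℝ)⁻¹ • x) = n * f ((n : ℝ)⁻¹ • x) :=
    fun n x hn => hindep _ _ x (hN x) hn
  let F : E →+ ℝ := AddMonoidHom.mk' (fun x => N x * f ((N x : ℝ)⁻¹ • x)) (by
    intro x y
    obtain ⟨n, hn⟩ := exists_nat_gt (‖x‖ + ‖y‖)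
    have hx : ‖x‖ < n := by linarith [norm_nonneg y]
    have hy : ‖y‖ < n := by linarith [norm_nonneg x]
    have hxy : ‖x + y‖ < n := (norm_add_le x y).trans_lt hn
    rw [hF n x hx, hF n y hy, hF n (x + y) hxy, smul_add, hadd _ _ (hlt n x hx) (hlt n y hy) (by
      rw [← smul_add]; exact hlt n _ hxy)]
    ring)
  have hFf : ∀ x, ‖x‖ < 1 → F x = f x := by
    intro x hx
    have := hF 1 x (by simpa using hx)
    simpa using! this
  have hFc : Continuous F := by
    refine continuous_of_continuousAt_zero F (hc.congr ?_)
    filter_upwards [Metric.ball_mem_nhds (0 : E) one_pos] with x hx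
    exact (hFf x (by simpa using hx)).symm
  refine ⟨(InnerProductSpace.toDual ℝ E).symm (F.toRealLinearMap hFc), fun x hx => ?_⟩
  rw [InnerProductSpace.toDual_symm_apply, ← hFf x hx]
  rfl

end Additive

/-! ### Construction of the operator T_q. -/

/-- The function `K_q^{1/2} 1_𝔹`, `q = k + 4`. -/
def weight (d k : ℕ) : Rd d → ℝ := (unitBall d).indicator fun x => √(ballPow d (k + 2) x)

/-- The function `K_q^{-1/2} 1_𝔹`, `q = k + 4`. -/
def invWeight (d k : ℕ) : Rd d → ℝ := (unitBall d).indicator fun x => (√(ballPow d (k + 2) x))⁻¹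

/-- K_q is positive up to radius q - 1 > 1. Being continuous, it is bounded away from zero on the
closed ball, so K_q^{-1/2} is bounded there. -/
theorem ballPow_pos_of_mem {d : ℕ} (k : ℕ) {x : Rd d} (hx : x ∈ unitBall d) :
    0 < ballPow d (k + 2) x := by
  refine ballPow_pos d (k + 2) ?_
  have : ‖x‖ ≤ 1 := by simpa [unitBall] using hx
  push_cast
  linarith [(Nat.cast_nonneg k : (0 : ℝ) ≤ k)]

theorem weight_mul_invWeight {d : ℕ} (k : ℕ) {x : Rd d} (hx : x ∈ unitBall d) :
    weight d k x * invWeight d k x = 1 := by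
  simp only [weight, invWeight, Set.indicator_of_mem hx]
  exact mul_inv_cancel₀ (Real.sqrt_pos.mpr (ballPow_pos_of_mem k hx)).ne'

theorem weight_sq {d : ℕ} (k : ℕ) {x : Rd d} (hx : x ∈ unitBall d) :
    weight d k x ^ 2 = ballPow d (k + 2) x := by
  simp only [weight, Set.indicator_of_mem hx]
  exact Real.sq_sqrt (ballPow_nonneg _ _ _)

theorem indicator_unitBall_neg {d : ℕ} {F : Rd d → ℝ} (hF : ∀ x, F (-x) = F x) (x : Rd d) :
    (unitBall d).indicator F (-x) = (unitBall d).indicator F x := by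
  by_cases h : x ∈ unitBall d
  · simp [h, neg_mem_unitBall.mpr h, hF]
  · simp [h, mt neg_mem_unitBall.mp h]

theorem weight_neg (d k : ℕ) (x : Rd d) : weight d k (-x) = weight d k x :=
  indicator_unitBall_neg (fun x => by rw [ballPow_neg]) x

theorem invWeight_neg (d k : ℕ) (x : Rd d) : invWeight d k (-x) = invWeight d k x :=
  indicator_unitBall_neg (fun x => by rw [ballPow_neg]) x

theorem bddMeas_indicator_unitBall {d : ℕ} {F : Rd d → ℝ} (hF : Measurable F)
    (hc : ContinuousOn F (unitBall d)) : BddMeas ((unitBall d).indicator F) := by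
  obtain ⟨C, hC⟩ := (isCompact_closedBall (0 : Rd d) 1).exists_bound_of_continuousOn hc
  refine ⟨hF.indicator (measurableSet_unitBall d), max C 0, fun x => ?_⟩
  by_cases h : x ∈ unitBall d
  · rw [Set.indicator_of_mem h]
    exact (hC x h).trans (le_max_left _ _)
  · simp [h]

theorem bddMeas_weight (d k : ℕ) : BddMeas (weight d k) :=
  bddMeas_indicator_unitBall (measurable_ballPow d _).sqrt
    (continuous_ballPow_succ d (k + 1)).sqrt.continuousOn

theorem continuousOn_inv_sqrt_ballPow (d k : ℕ) :
    ContinuousOn (fun x => (√(ballPow d (k + 2) x))⁻¹) (unitBall d) :=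
  (continuous_ballPow_succ d (k + 1)).sqrt.continuousOn.inv₀ fun _ hx =>
    (Real.sqrt_pos.mpr (ballPow_pos_of_mem k hx)).ne'

theorem bddMeas_invWeight (d k : ℕ) : BddMeas (invWeight d k) :=
  bddMeas_indicator_unitBall (measurable_ballPow d _).sqrt.inv (continuousOn_inv_sqrt_ballPow d k)

theorem bddMeas_kernelSection (d k : ℕ) (x : Rd d) :
    BddMeas fun y => invWeight d k y * ballPow d (k + 1) (x - y) :=
  (bddMeas_invWeight d k).mul
    ((bddMeas_ballPow d (k + 1)).comp (measurable_const.sub measurable_id))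

/-- The function `y ↦ K_q(y)^{-1/2} L_q(x - y)`, as an element of `L²(𝔹)`. -/
def kernelSection (d k : ℕ) (x : Rd d) : L2Ball d :=
  ((bddMeas_kernelSection d k x).memLp 2 (ballMeasure d)).toLp

/-- L_q is continuous with compact support, hence uniformly continuous, so nearby sections are
uniformly close. This gives the strong measurability of the vector-valued kernel of T_q and the
continuity of potentials. -/
theorem continuous_kernelSection (d k : ℕ) : Continuous (kernelSection d k) := by
  obtain ⟨-, C, hC⟩ := bddMeas_invWeight d k
  have hC0 : 0 ≤ C := (norm_nonneg _).trans (hC 0)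
  have hu : UniformContinuous (ballPow d (k + 1)) :=
    (hasCompactSupport_ballPow d (k + 1)).uniformContinuous_of_continuous
      (continuous_ballPow_succ d k)
  set A : ℝ := (measureUnivNNReal (ballMeasure d) : ℝ) ^ (2 : ENNReal).toReal⁻¹
  have hA : 0 ≤ A := by positivity
  refine Metric.continuous_iff.mpr fun x ε hε => ?_
  have hpos : 0 < A * C + 1 := by positivity
  obtain ⟨δ, hδ, h⟩ := Metric.uniformContinuous_iff.mp hu (ε / (A * C + 1)) (by positivity)
  refine ⟨δ, hδ, fun x' hx' => ?_⟩
  rw [dist_eq_norm, kernelSection, kernelSection, ← MemLp.toLp_sub]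
  have hb : ‖(((bddMeas_kernelSection d k x').memLp 2 (ballMeasure d)).sub
      ((bddMeas_kernelSection d k x).memLp 2 (ballMeasure d))).toLp‖
      ≤ A * (C * (ε / (A * C + 1))) := by
    refine Lp.norm_le_of_ae_bound (by positivity) ?_
    filter_upwards [MemLp.coeFn_toLp (((bddMeas_kernelSection d k x').memLp 2 (ballMeasure d)).sub
      ((bddMeas_kernelSection d k x).memLp 2 (ballMeasure d)))] with y hy
    rw [hy, Pi.sub_apply, ← mul_sub, norm_mul]
    refine mul_le_mul (hC y) ?_ (norm_nonneg _) hC0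
    rw [← dist_eq_norm]
    exact (h (by simpa [dist_eq_norm] using hx')).le
  refine hb.trans_lt ?_
  rw [← mul_assoc, ← mul_div_assoc, div_lt_iff₀ hpos]
  nlinarith

theorem exists_norm_kernelSection_le (d k : ℕ) : ∃ C, ∀ x, ‖kernelSection d k x‖ ≤ C := by
  obtain ⟨-, C, hC⟩ := bddMeas_invWeight d k
  obtain ⟨-, D, hD⟩ := bddMeas_ballPow d (k + 1)
  have hC0 : 0 ≤ C := (norm_nonneg _).trans (hC 0)
  have hD0 : 0 ≤ D := (norm_nonneg _).trans (hD 0)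
  refine ⟨_, fun x => Lp.norm_le_of_ae_bound (C := C * D) (by positivity) ?_⟩
  filter_upwards [MemLp.coeFn_toLp ((bddMeas_kernelSection d k x).memLp 2 (ballMeasure d))]
    with y hy
  rw [kernelSection, hy, norm_mul]
  exact mul_le_mul (hC y) (hD _) (norm_nonneg _) hC0

theorem memLp_kernel (d k : ℕ) :
    MemLp (fun x => invWeight d k x • kernelSection d k x) 2 (ballMeasure d) := by
  obtain ⟨hm, C, hC⟩ := bddMeas_invWeight d k
  obtain ⟨D, hD⟩ := exists_norm_kernelSection_le d k
  refine MemLp.of_bound (hm.stronglyMeasurable.smul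
    (continuous_kernelSection d k).stronglyMeasurable).aestronglyMeasurable (C * D)
    (ae_of_all _ fun x => ?_)
  rw [norm_smul]
  exact mul_le_mul (hC x) (hD x) (norm_nonneg _) ((norm_nonneg _).trans (hC x))

/-- The operator `T_q`, `q = k + 4`. -/
def ballOp (d k : ℕ) : L2Ball d →L[ℝ] L2Ball d :=
  kernelOp (L2Ball d) (ballMeasure d) (memLp_kernel d k).toLp

theorem isCompactOperator_ballOp (d k : ℕ) : IsCompactOperator (ballOp d k) :=
  isCompactOperator_kernelOp _

/-- The function `(K_q^{-1/2} h 1_𝔹) * L_q`. -/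
def potential (d k : ℕ) (h : Rd d → ℝ) (x : Rd d) : ℝ :=
  ∫ y, invWeight d k y * h y * ballPow d (k + 1) (x - y) ∂ballMeasure d

theorem inner_kernelSection (d k : ℕ) (h : L2Ball d) (x : Rd d) :
    inner ℝ h (kernelSection d k x) = potential d k h x := by
  rw [L2.inner_def, potential]
  refine integral_congr_ae ?_
  filter_upwards [MemLp.coeFn_toLp ((bddMeas_kernelSection d k x).memLp 2 (ballMeasure d))]
    with y hy
  rw [kernelSection, hy, real_inner_eq_re_inner]
  simp
  ring

theorem continuous_potential (d k : ℕ) (h : L2Ball d) : Continuous (potential d k h) := by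
  have : potential d k h = fun x => inner ℝ h (kernelSection d k x) :=
    funext fun x => (inner_kernelSection d k h x).symm
  rw [this]
  exact continuous_const.inner (continuous_kernelSection d k)

theorem bddMeas_potential (d k : ℕ) (h : L2Ball d) : BddMeas (potential d k h) := by
  obtain ⟨D, hD⟩ := exists_norm_kernelSection_le d k
  refine ⟨(continuous_potential d k h).measurable, ‖h‖ * D, fun x => ?_⟩
  rw [← inner_kernelSection]
  exact (norm_inner_le_norm _ _).trans (by gcongr; exact hD x)

theorem potential_congr {d : ℕ} (k : ℕ) {g h : Rd d → ℝ} (hgh : g =ᵐ[ballMeasure d] h) (x : Rd d) :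
    potential d k g x = potential d k h x := by
  refine integral_congr_ae ?_
  filter_upwards [hgh] with y hy
  rw [hy]

theorem ballOp_ae (d k : ℕ) (h : L2Ball d) :
    ballOp d k h =ᵐ[ballMeasure d] fun x => invWeight d k x * potential d k h x := by
  filter_upwards [kernelOp_apply (memLp_kernel d k).toLp h, (memLp_kernel d k).coeFn_toLp]
    with x h1 h2
  rw [ballOp, h1, h2, inner_smul_right, inner_kernelSection]

theorem integrable_kernel_form (d k : ℕ) {f h : Rd d → ℝ} (hf : Integrable f (ballMeasure d))
    (hh : Integrable h (ballMeasure d)) :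
    Integrable (fun p : Rd d × Rd d => (invWeight d k p.1 * f p.1) *
      (invWeight d k p.2 * h p.2 * ballPow d (k + 1) (p.1 - p.2)))
      ((ballMeasure d).prod (ballMeasure d)) := by
  have hb : BddMeas fun p : Rd d × Rd d => invWeight d k p.1 * invWeight d k p.2 *
      ballPow d (k + 1) (p.1 - p.2) :=
    bddMeas_prod_mul_ballPow_sub d (k + 1) (((bddMeas_invWeight d k).comp measurable_fst).mul
      ((bddMeas_invWeight d k).comp measurable_snd))
  obtain ⟨hm, C, hC⟩ := hb
  refine ((hf.mul_prod hh).bdd_mul hm.aestronglyMeasurable (ae_of_all _ hC)).congr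
    (ae_of_all _ fun p => ?_)
  simp only
  ring

theorem integrable_L2Ball {d : ℕ} (h : L2Ball d) : Integrable h (ballMeasure d) :=
  (Lp.memLp h).integrable one_le_two

theorem inner_ballOp (d k : ℕ) (f h : L2Ball d) :
    inner ℝ f (ballOp d k h) = ∫ x, ∫ y, (invWeight d k x * f x) *
      (invWeight d k y * h y * ballPow d (k + 1) (x - y)) ∂ballMeasure d ∂ballMeasure d := by
  rw [L2.inner_def]
  refine integral_congr_ae ?_
  filter_upwards [ballOp_ae d k h] with x hx
  rw [hx, integral_const_mul, ← potential, real_inner_eq_re_inner]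
  simp
  ring

theorem inner_ballOp_symm (d k : ℕ) (f h : L2Ball d) :
    inner ℝ f (ballOp d k h) = inner ℝ (ballOp d k f) h := by
  rw [real_inner_comm h (ballOp d k f), inner_ballOp, inner_ballOp, integral_integral_swap
    (integrable_kernel_form d k (integrable_L2Ball f) (integrable_L2Ball h))]
  congr 1
  ext x
  congr 1
  ext y
  rw [ballPow_sub_comm]
  ring

/-! ### Reflection, and its commutation with T_q. -/

/-- The reflection `h ↦ h̃` as a linear isometry. -/
def reflectionₗᵢ (d : ℕ) : L2Ball d →ₗᵢ[ℝ] L2Ball d :=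
  Lp.compMeasurePreservingₗᵢ ℝ (fun x : Rd d => -x) (measurePreserving_neg_ball d)

theorem reflectionₗᵢ_apply (d : ℕ) (h : L2Ball d) : reflectionₗᵢ d h = reflection d h := rfl

theorem reflectionₗᵢ_ae {d : ℕ} (h : L2Ball d) :
    reflectionₗᵢ d h =ᵐ[ballMeasure d] fun x => h (-x) :=
  Lp.coeFn_compMeasurePreserving h (measurePreserving_neg_ball d)

theorem ae_comp_neg {d : ℕ} {p : Rd d → Prop} (hp : ∀ᵐ x ∂ballMeasure d, p x) :
    ∀ᵐ x ∂ballMeasure d, p (-x) :=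
  (measurePreserving_neg_ball d).quasiMeasurePreserving.ae hp

theorem reflectionₗᵢ_reflectionₗᵢ {d : ℕ} (h : L2Ball d) :
    reflectionₗᵢ d (reflectionₗᵢ d h) = h := by
  refine Lp.ext ?_
  filter_upwards [reflectionₗᵢ_ae (reflectionₗᵢ d h), ae_comp_neg (reflectionₗᵢ_ae h)] with x h1 h2
  rw [h1, h2, neg_neg]

theorem inner_reflectionₗᵢ {d : ℕ} (f h : L2Ball d) :
    inner ℝ f (reflectionₗᵢ d h) = inner ℝ (reflectionₗᵢ d f) h := by
  rw [← (reflectionₗᵢ d).inner_map_map f, reflectionₗᵢ_reflectionₗᵢ]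

theorem potential_neg (d k : ℕ) (h : Rd d → ℝ) (x : Rd d) :
    potential d k h (-x) = potential d k (fun y => h (-y)) x := by
  rw [potential, ← integral_neg_ballMeasure]
  refine integral_congr_ae (ae_of_all _ fun y => ?_)
  simp only [invWeight_neg]
  rw [← ballPow_neg]
  congr 2
  abel

theorem ballOp_reflectionₗᵢ (d k : ℕ) (h : L2Ball d) :
    ballOp d k (reflectionₗᵢ d h) = reflectionₗᵢ d (ballOp d k h) := by
  refine Lp.ext ?_
  filter_upwards [ballOp_ae d k (reflectionₗᵢ d h), reflectionₗᵢ_ae (ballOp d k h),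
    ae_comp_neg (ballOp_ae d k h)] with x h1 h2 h3
  rw [h1, h2, h3, invWeight_neg, potential_neg, potential_congr k (reflectionₗᵢ_ae h)]

theorem isT_ballOp (d k : ℕ) (hk : Even k) : IsT d ((k + 4 : ℕ) : ℝ) (ballOp d k) := by
  intro h
  filter_upwards [ballOp_ae d k h, ae_restrict_mem (measurableSet_unitBall d)] with x hx hxB
  rw [hx, TFun, invWeight, Set.indicator_of_mem hxB, K_eq_ballPow d k hk]
  congr 1
  rw [convolution_def, potential, integral_ballMeasure]
  congr 1
  ext y
  by_cases hy : y ∈ unitBall d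
  · rw [ballPow_zero_of_mem hy, invWeight, Set.indicator_of_mem hy, Set.indicator_of_mem hy,
      ContinuousLinearMap.mul_apply', K_eq_ballPow d k hk, L_eq_ballPow d k hk, one_mul]
  · rw [ballPow_zero_of_notMem hy, Set.indicator_of_notMem hy, map_zero,
      zero_apply, zero_mul]

/-! ### The substitution h = K_q^{1/2} f. -/

theorem ae_mem_unitBall (d : ℕ) : ∀ᵐ x ∂ballMeasure d, x ∈ unitBall d :=
  ae_restrict_mem (measurableSet_unitBall d)

/-- The element `K_q^{1/2} f` of `L²(𝔹)`, `q = k + 4`. -/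
def lift {d : ℕ} (k : ℕ) {f : Rd d → ℝ} (hf : BddMeas f) : L2Ball d :=
  (((bddMeas_weight d k).mul hf).memLp 2 (ballMeasure d)).toLp

theorem lift_ae {d : ℕ} (k : ℕ) {f : Rd d → ℝ} (hf : BddMeas f) :
    lift k hf =ᵐ[ballMeasure d] fun x => weight d k x * f x :=
  MemLp.coeFn_toLp _

theorem lift_eq_of_ae {d : ℕ} (k : ℕ) {f : Rd d → ℝ} (hf : BddMeas f) {h : L2Ball d}
    (hh : h =ᵐ[ballMeasure d] fun x => weight d k x * f x) : h = lift k hf :=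
  Lp.ext (hh.trans (lift_ae k hf).symm)

theorem norm_lift_sq {d : ℕ} (k : ℕ) {f : Rd d → ℝ} (hf : BddMeas f) :
    ‖lift k hf‖ ^ 2 = weightedSq d (k + 2) f := by
  rw [← real_inner_self_eq_norm_sq, L2.inner_def, weightedSq]
  refine integral_congr_ae ?_
  filter_upwards [lift_ae k hf, ae_mem_unitBall d] with x hx hxB
  rw [hx, real_inner_self_eq_norm_sq, Real.norm_eq_abs, sq_abs, mul_pow, weight_sq k hxB, mul_comm]

theorem inner_lift_ballOp_lift {d : ℕ} (k : ℕ) {f : Rd d → ℝ} (hf : BddMeas f) :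
    inner ℝ (lift k hf) (ballOp d k (lift k hf)) = convForm d (k + 1) f := by
  have h : ∀ᵐ x ∂ballMeasure d, invWeight d k x * lift k hf x = f x := by
    filter_upwards [lift_ae k hf, ae_mem_unitBall d] with x hx hxB
    rw [hx, ← mul_assoc, mul_comm (invWeight d k x), weight_mul_invWeight k hxB, one_mul]
  rw [inner_ballOp, convForm]
  refine integral_congr_ae ?_
  filter_upwards [h] with x hx
  refine integral_congr_ae ?_
  filter_upwards [h] with y hy
  rw [hx, hy, mul_assoc]

theorem reflectionₗᵢ_lift {d : ℕ} (k : ℕ) {f : Rd d → ℝ} (hf : BddMeas f) :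
    reflectionₗᵢ d (lift k hf) = lift k (hf.comp measurable_neg) := by
  refine lift_eq_of_ae k _ ?_
  filter_upwards [reflectionₗᵢ_ae (lift k hf), ae_comp_neg (lift_ae k hf)] with x h1 h2
  rw [h1, h2, weight_neg]

/-- Bounded continuous g are dense in L², and each is the lift of K_q^{-1/2} g. Closed inequalities
thus need checking only for bounded f, where every integral converges. -/
theorem dense_lift (d k : ℕ) :
    Dense {h : L2Ball d | ∃ (f : Rd d → ℝ) (hf : BddMeas f), h = lift k hf} := by
  have : (ballMeasure d).WeaklyRegular := by unfold ballMeasure; infer_instance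
  refine (BoundedContinuousFunction.toLp_denseRange (E := ℝ) (𝕜 := ℝ) (μ := ballMeasure d)
    (p := 2) ENNReal.ofNat_ne_top).mono ?_
  rintro _ ⟨g, rfl⟩
  have hg : BddMeas g := ⟨g.continuous.measurable, ‖g‖, g.norm_coe_le_norm⟩
  refine ⟨fun x => invWeight d k x * g x, (bddMeas_invWeight d k).mul hg, lift_eq_of_ae k _ ?_⟩
  filter_upwards [BoundedContinuousFunction.coeFn_toLp (p := 2) (𝕜 := ℝ) (ballMeasure d) g,
    ae_mem_unitBall d] with x hx hxB
  rw [hx, ← mul_assoc, weight_mul_invWeight k hxB, one_mul]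

/-! ### Parity decomposition and positivity of 1 - C. -/

/-- The odd part of an element of `L²(𝔹)`. -/
def oddPart {d : ℕ} (h : L2Ball d) : L2Ball d := (1 / 2 : ℝ) • (h - reflectionₗᵢ d h)

/-- The even part of an element of `L²(𝔹)`. -/
def evenPart {d : ℕ} (h : L2Ball d) : L2Ball d := (1 / 2 : ℝ) • (h + reflectionₗᵢ d h)

theorem evenPart_add_oddPart {d : ℕ} (h : L2Ball d) : evenPart h + oddPart h = h := by
  rw [evenPart, oddPart, ← smul_add, add_add_sub_cancel, ← two_smul ℝ, smul_smul]
  norm_num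

theorem reflectionₗᵢ_evenPart {d : ℕ} (h : L2Ball d) :
    reflectionₗᵢ d (evenPart h) = evenPart h := by
  rw [evenPart, map_smul, map_add, reflectionₗᵢ_reflectionₗᵢ, add_comm]

theorem reflectionₗᵢ_oddPart {d : ℕ} (h : L2Ball d) :
    reflectionₗᵢ d (oddPart h) = -oddPart h := by
  rw [oddPart, map_smul, map_sub, reflectionₗᵢ_reflectionₗᵢ, ← smul_neg, neg_sub]

theorem bddMeas_odd {d : ℕ} {f : Rd d → ℝ} (hf : BddMeas f) :
    BddMeas fun x => (1 / 2 : ℝ) * (f x - f (-x)) :=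
  (BddMeas.const _).mul (hf.sub (hf.comp measurable_neg))

theorem oddPart_lift {d : ℕ} (k : ℕ) {f : Rd d → ℝ} (hf : BddMeas f) :
    oddPart (lift k hf) = lift k (bddMeas_odd hf) := by
  refine lift_eq_of_ae k _ ?_
  rw [oddPart, reflectionₗᵢ_lift]
  filter_upwards [Lp.coeFn_smul (1 / 2 : ℝ) (lift k hf - lift k (hf.comp measurable_neg)),
    Lp.coeFn_sub (lift k hf) (lift k (hf.comp measurable_neg)), lift_ae k hf,
    lift_ae k (hf.comp measurable_neg)] with x h1 h2 h3 h4
  rw [h1, Pi.smul_apply, h2, Pi.sub_apply, h3, h4, smul_eq_mul]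
  ring

theorem convForm_le_weightedSq (d k : ℕ) {f : Rd d → ℝ} (hf : BddMeas f) :
    convForm d k f ≤ weightedSq d (k + 1) f := by
  have h := integral_sub_sq d k hf
  have h0 : 0 ≤ ∫ x, ∫ y, (f x - f y) ^ 2 * ballPow d k (x - y) ∂ballMeasure d ∂ballMeasure d :=
    integral_nonneg fun x => integral_nonneg fun y =>
      mul_nonneg (sq_nonneg _) (ballPow_nonneg _ _ _)
  linarith

theorem mul_convForm_le_weightedSq (d k : ℕ) {f : Rd d → ℝ} (hf : BddMeas f)
    (hodd : ∀ x, f (-x) = -f x) :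
    (k + 3) * convForm d (k + 1) f ≤ weightedSq d (k + 2) f := by
  have h := integral_sum_sub_sq d k hf hodd
  have h0 : 0 ≤ ∫ x, (∑ i, f (x i) - f (∑ i, x i)) ^ 2 * ballPow d 0 (∑ i, x i)
      ∂ballPi d (k + 3) :=
    integral_nonneg fun x => mul_nonneg (sq_nonneg _) (ballPow_nonneg _ _ _)
  rw [h] at h0
  have := nonneg_of_mul_nonneg_right h0 (by positivity)
  linarith

theorem inner_ballOp_le (d k : ℕ) (h : L2Ball d) : inner ℝ h (ballOp d k h) ≤ ‖h‖ ^ 2 := by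
  refine (dense_lift d k).induction (P := fun h => inner ℝ h (ballOp d k h) ≤ ‖h‖ ^ 2) ?_ ?_ h
  · rintro _ ⟨f, hf, rfl⟩
    rw [inner_lift_ballOp_lift, norm_lift_sq]
    exact convForm_le_weightedSq d (k + 1) hf
  · exact isClosed_le (by fun_prop) (by fun_prop)

/-- Stating the bound for `oddPart h` with h arbitrary lets the density of lifts in all of L² be
used directly; the odd part of a lift is the lift of a function odd at every point. -/
theorem mul_inner_ballOp_oddPart_le (d k : ℕ) (h : L2Ball d) :
    (k + 3) * inner ℝ (oddPart h) (ballOp d k (oddPart h)) ≤ ‖oddPart h‖ ^ 2 := by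
  refine (dense_lift d k).induction
    (P := fun h => (k + 3) * inner ℝ (oddPart h) (ballOp d k (oddPart h)) ≤ ‖oddPart h‖ ^ 2)
    ?_ ?_ h
  · rintro _ ⟨f, hf, rfl⟩
    rw [oddPart_lift, inner_lift_ballOp_lift, norm_lift_sq]
    exact mul_convForm_le_weightedSq d k (bddMeas_odd hf) fun x => by rw [neg_neg]; ring
  · have hc : Continuous fun h : L2Ball d => oddPart h := by
      unfold oddPart
      have := (reflectionₗᵢ d).continuous
      fun_prop
    exact isClosed_le (by fun_prop) (by fun_prop)

/-- The compact part `C` of the form, `q = k + 4`: the form is `-(q/2) ⟨h, (1 - C) h⟩`. -/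
def compactPart (d k : ℕ) : L2Ball d →L[ℝ] L2Ball d :=
  ((k + 4 : ℝ) / 2) • ballOp d k
    - ((k + 2 : ℝ) / 2) • (ballOp d k ∘L (reflectionₗᵢ d).toContinuousLinearMap)

theorem compactPart_apply (d k : ℕ) (h : L2Ball d) :
    compactPart d k h = ((k + 4 : ℝ) / 2) • ballOp d k h
      - ((k + 2 : ℝ) / 2) • ballOp d k (reflectionₗᵢ d h) := rfl

theorem isCompactOperator_compactPart (d k : ℕ) : IsCompactOperator (compactPart d k) :=
  ((isCompactOperator_ballOp d k).smul _).sub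
    (((isCompactOperator_ballOp d k).comp_clm _).smul _)

theorem compactPart_of_even {d : ℕ} (k : ℕ) {h : L2Ball d} (hh : reflectionₗᵢ d h = h) :
    compactPart d k h = ballOp d k h := by
  rw [compactPart_apply, hh, ← sub_smul]
  convert! one_smul ℝ _
  ring

theorem compactPart_of_odd {d : ℕ} (k : ℕ) {h : L2Ball d} (hh : reflectionₗᵢ d h = -h) :
    compactPart d k h = (k + 3 : ℝ) • ballOp d k h := by
  rw [compactPart_apply, hh, map_neg, smul_neg, sub_neg_eq_add, ← add_smul]
  congr 1
  ring

theorem inner_compactPart_symm (d k : ℕ) (f h : L2Ball d) :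
    inner ℝ f (compactPart d k h) = inner ℝ (compactPart d k f) h := by
  simp only [compactPart_apply, inner_sub_left, inner_sub_right, inner_smul_left, inner_smul_right,
    conj_trivial, inner_ballOp_symm d k f, ballOp_reflectionₗᵢ]
  rw [inner_reflectionₗᵢ, inner_ballOp_symm, ballOp_reflectionₗᵢ]

theorem compactPart_reflectionₗᵢ (d k : ℕ) (h : L2Ball d) :
    compactPart d k (reflectionₗᵢ d h) = reflectionₗᵢ d (compactPart d k h) := by
  simp only [compactPart_apply, map_sub, map_smul, ballOp_reflectionₗᵢ]

theorem inner_eq_zero_of_even_of_odd {d : ℕ} {f h : L2Ball d} (hf : reflectionₗᵢ d f = f)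
    (hh : reflectionₗᵢ d h = -h) : inner ℝ f h = 0 := by
  have h1 := inner_reflectionₗᵢ f h
  rw [hf, hh, inner_neg_right] at h1
  linarith

/-- T preserves parity, and functions of opposite parity are orthogonal, so all cross terms vanish.
-/
theorem inner_sub_compactPart (d k : ℕ) (h : L2Ball d) :
    inner ℝ h (h - compactPart d k h)
      = (‖evenPart h‖ ^ 2 - inner ℝ (evenPart h) (ballOp d k (evenPart h)))
        + (‖oddPart h‖ ^ 2 - (k + 3) * inner ℝ (oddPart h) (ballOp d k (oddPart h))) := by
  have he := reflectionₗᵢ_evenPart h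
  have ho := reflectionₗᵢ_oddPart h
  have hTe : reflectionₗᵢ d (ballOp d k (evenPart h)) = ballOp d k (evenPart h) := by
    rw [← ballOp_reflectionₗᵢ, he]
  have hTo : reflectionₗᵢ d (ballOp d k (oddPart h)) = -ballOp d k (oddPart h) := by
    rw [← ballOp_reflectionₗᵢ, ho, map_neg]
  have hC : compactPart d k h
      = ballOp d k (evenPart h) + (k + 3 : ℝ) • ballOp d k (oddPart h) := by
    nth_rewrite 1 [← evenPart_add_oddPart h]
    rw [map_add, compactPart_of_even k he, compactPart_of_odd k ho]
  rw [hC]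
  nth_rewrite 1 2 [← evenPart_add_oddPart h]
  simp only [inner_add_left, inner_add_right, inner_sub_right, inner_smul_right,
    inner_eq_zero_of_even_of_odd he ho, inner_eq_zero_of_even_of_odd he hTo,
    real_inner_comm (evenPart h) (oddPart h), real_inner_self_eq_norm_sq,
    real_inner_comm (ballOp d k (evenPart h)) (oddPart h), inner_eq_zero_of_even_of_odd hTe ho]
  ring

theorem inner_sub_compactPart_nonneg (d k : ℕ) (h : L2Ball d) :
    0 ≤ inner ℝ h (h - compactPart d k h) := by
  rw [inner_sub_compactPart]
  have h1 := inner_ballOp_le d k (evenPart h)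
  have h2 := mul_inner_ballOp_oddPart_le d k h
  linarith

theorem compactPart_eq_self_iff (d k : ℕ) (h : L2Ball d) :
    compactPart d k h = h ↔ ballOp d k (evenPart h) = evenPart h ∧
      (k + 3 : ℝ) • ballOp d k (oddPart h) = oddPart h := by
  rw [← compactPart_of_even k (reflectionₗᵢ_evenPart h),
    ← compactPart_of_odd k (reflectionₗᵢ_oddPart h)]
  constructor
  · intro hC
    constructor
    · rw [evenPart, map_smul, map_add, compactPart_reflectionₗᵢ, hC]
    · rw [oddPart, map_smul, map_sub, compactPart_reflectionₗᵢ, hC]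
  · rintro ⟨h1, h2⟩
    rw [← evenPart_add_oddPart h, map_add, h1, h2]

/-- For a positive semidefinite form, Cauchy–Schwarz puts every null vector in the kernel. -/
theorem compactPart_eq_self_of_inner_eq_zero {d k : ℕ} {h : L2Ball d}
    (hh : inner ℝ h (h - compactPart d k h) = 0) : compactPart d k h = h := by
  have := norm_sq_le_of_nonneg (1 - compactPart d k) (fun x y => by
    simp [inner_sub_left, inner_sub_right, inner_compactPart_symm])
    (fun x => by simpa using inner_sub_compactPart_nonneg d k x) h
  simp only [sub_apply, one_apply_eq_self, hh, mul_zero] at this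
  have h0 : ‖h - compactPart d k h‖ = 0 := by nlinarith [norm_nonneg (h - compactPart d k h)]
  exact (sub_eq_zero.mp (norm_eq_zero.mp h0)).symm

/-! ### The kernel of 1 - C is ℋ. -/

theorem ball_subset_unitBall (d : ℕ) : Metric.ball 0 1 ⊆ unitBall d :=
  Metric.ball_subset_closedBall

theorem ae_mem_ball (d : ℕ) : ∀ᵐ x ∂ballMeasure d, x ∈ Metric.ball (0 : Rd d) 1 := by
  have h0 : volume (Metric.sphere (0 : Rd d) 1) = 0 :=
    Measure.addHaar_sphere_of_ne_zero _ _ one_ne_zero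
  filter_upwards [ae_mem_unitBall d,
    ae_restrict_of_ae (measure_eq_zero_iff_ae_notMem.mp h0)] with x hx hx'
  have h1 : ‖x‖ ≤ 1 := by simpa [unitBall] using hx
  have h2 : ‖x‖ ≠ 1 := by simpa using hx'
  simpa using lt_of_le_of_ne h1 h2

/-- An eigenvector of `T_q` with nonzero eigenvalue is `K_q^{1/2}` times a bounded function that is
continuous on the open ball. -/
theorem exists_lift_of_eq_smul_ballOp {d k : ℕ} {h : L2Ball d} {c : ℝ}
    (hh : c • ballOp d k h = h) :
    ∃ (f : Rd d → ℝ) (hf : BddMeas f), ContinuousOn f (Metric.ball 0 1) ∧ h = lift k hf := by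
  -- The eigenvalue equation gives f = K_q^{-1/2} h = c K_q^{-1} times the potential of h, and the
  -- potential is continuous even though h is only an L² class.
  refine ⟨fun x => c * (invWeight d k x * (invWeight d k x * potential d k h x)),
    (BddMeas.const c).mul ((bddMeas_invWeight d k).mul ((bddMeas_invWeight d k).mul
      (bddMeas_potential d k h))), ?_, lift_eq_of_ae k _ ?_⟩
  · have h1 : ContinuousOn (invWeight d k) (Metric.ball 0 1) :=
      ((continuousOn_inv_sqrt_ballPow d k).mono Metric.ball_subset_closedBall).congr
        fun x hx => Set.indicator_of_mem (Metric.ball_subset_closedBall hx) _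
    exact continuousOn_const.mul (h1.mul (h1.mul (continuous_potential d k h).continuousOn))
  · have h2 : ∀ᵐ x ∂ballMeasure d, (c • ballOp d k h) x = h x := by
      rw [hh]
      exact ae_of_all _ fun _ => rfl
    filter_upwards [h2, Lp.coeFn_smul c (ballOp d k h), ballOp_ae d k h, ae_mem_unitBall d]
      with x h2 h3 h4 hxB
    rw [← h2, h3, Pi.smul_apply, h4, smul_eq_mul]
    linear_combination
      (-c * invWeight d k x * potential d k h x) * weight_mul_invWeight k hxB

/-- The integral of squares vanishes. Its weight L_q(x-y) is positive for x, y in the open ball,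
because ‖x-y‖ < 2 ≤ q - 2; so f(x) = f(y) almost everywhere, and then everywhere by continuity. -/
theorem eq_of_convForm_eq {d k : ℕ} {f : Rd d → ℝ} (hf : BddMeas f)
    (hc : ContinuousOn f (Metric.ball 0 1))
    (h : convForm d (k + 1) f = weightedSq d (k + 2) f) {x : Rd d} (hx : x ∈ Metric.ball 0 1) :
    f x = f 0 := by
  have hI := integral_sub_sq d (k + 1) hf
  rw [h, sub_self] at hI
  have hb : BddMeas fun p : Rd d × Rd d => (f p.1 - f p.2) ^ 2 * ballPow d (k + 1) (p.1 - p.2) :=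
    bddMeas_prod_mul_ballPow_sub d (k + 1)
      (((hf.comp measurable_fst).sub (hf.comp measurable_snd)).pow 2)
  have hi := hb.integrable ((ballMeasure d).prod (ballMeasure d))
  have h0 := integral_prod _ hi
  rw [hI, integral_eq_zero_iff_of_nonneg
    (fun p => mul_nonneg (sq_nonneg _) (ballPow_nonneg _ _ _)) hi] at h0
  set U : Set (Rd d × Rd d) := Metric.ball 0 1 ×ˢ Metric.ball 0 1 with hU
  have hUo : IsOpen U := Metric.isOpen_ball.prod Metric.isOpen_ball
  rw [ballMeasure, Measure.prod_restrict] at h0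
  have h1 := ae_restrict_of_ae_restrict_of_subset (s := U)
    (Set.prod_mono Metric.ball_subset_closedBall Metric.ball_subset_closedBall) h0
  have h2 : (fun p : Rd d × Rd d => f p.1) =ᵐ[volume.restrict U] fun p => f p.2 := by
    filter_upwards [h1, ae_restrict_mem hUo.measurableSet] with p hp hpU
    have n1 : ‖p.1‖ < 1 := by simpa using hpU.1
    have n2 : ‖p.2‖ < 1 := by simpa using hpU.2
    have hpos : 0 < ballPow d (k + 1) (p.1 - p.2) := ballPow_pos d (k + 1) (by
      push_cast
      linarith [norm_sub_le p.1 p.2, (Nat.cast_nonneg k : (0 : ℝ) ≤ k)])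
    have h3 : (f p.1 - f p.2) ^ 2 = 0 := (mul_eq_zero.mp hp).resolve_right hpos.ne'
    exact sub_eq_zero.mp (pow_eq_zero_iff two_ne_zero |>.mp h3)
  have h3 := Measure.eqOn_open_of_ae_eq h2 hUo
    (hc.comp continuousOn_fst fun p hp => hp.1) (hc.comp continuousOn_snd fun p hp => hp.2)
  exact h3 (x := (x, 0)) ⟨hx, by simp⟩

theorem ballPi_eq_restrict (d k : ℕ) :
    ballPi d k = volume.restrict (Set.univ.pi fun _ : Fin k => unitBall d) := by
  rw [volume_pi, Measure.restrict_pi_pi]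
  rfl

/-- Again the integral of squares vanishes, so the identity holds almost everywhere on the open set
where all points and their sum lie in the open ball; continuity removes the exceptional set. -/
theorem sum_eq_of_convForm_eq {d k : ℕ} {f : Rd d → ℝ} (hf : BddMeas f)
    (hc : ContinuousOn f (Metric.ball 0 1)) (hodd : ∀ x, f (-x) = -f x)
    (h : (k + 3) * convForm d (k + 1) f = weightedSq d (k + 2) f) {x : Fin (k + 3) → Rd d}
    (hx : ∀ i, x i ∈ Metric.ball 0 1) (hs : ∑ i, x i ∈ Metric.ball 0 1) :
    ∑ i, f (x i) = f (∑ i, x i) := by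
  have h0 := integral_sum_sub_sq d k hf hodd
  have hb : BddMeas fun x : Fin (k + 3) → Rd d =>
      (∑ i, f (x i) - f (∑ i, x i)) ^ 2 * ballPow d 0 (∑ i, x i) :=
    (((BddMeas.sum _ fun i => hf.comp (measurable_pi_apply i)).sub
      (bddMeas_comp_sum hf)).pow 2).mul (bddMeas_comp_sum (bddMeas_ballPow d 0))
  rw [h, sub_self, mul_zero, integral_eq_zero_iff_of_nonneg
    (fun p => mul_nonneg (sq_nonneg _) (ballPow_nonneg _ _ _)) (hb.integrable _)] at h0
  set U : Set (Fin (k + 3) → Rd d) :=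
    (Set.univ.pi fun _ => Metric.ball 0 1) ∩ (fun x => ∑ i, x i) ⁻¹' Metric.ball 0 1 with hU
  have hsc : Continuous fun x : Fin (k + 3) → Rd d => ∑ i, x i := by fun_prop
  have hUo : IsOpen U := (isOpen_set_pi Set.finite_univ fun _ _ => Metric.isOpen_ball).inter
    (Metric.isOpen_ball.preimage hsc)
  rw [ballPi_eq_restrict] at h0
  have h1 := ae_restrict_of_ae_restrict_of_subset (s := U)
    (fun y hy i hi => Metric.ball_subset_closedBall (hy.1 i hi)) h0
  have h2 : (fun x : Fin (k + 3) → Rd d => ∑ i, f (x i)) =ᵐ[volume.restrict U]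
      fun x => f (∑ i, x i) := by
    filter_upwards [h1, ae_restrict_mem hUo.measurableSet] with y hy hyU
    have h3 : ballPow d 0 (∑ i, y i) = 1 :=
      ballPow_zero_of_mem (Metric.ball_subset_closedBall hyU.2)
    simp only [h3, mul_one, Pi.zero_apply] at hy
    exact sub_eq_zero.mp (pow_eq_zero_iff two_ne_zero |>.mp hy)
  exact Measure.eqOn_open_of_ae_eq h2 hUo
    (continuousOn_finsetSum _ fun i _ => hc.comp (continuous_apply i).continuousOn
      fun y hy => hy.1 i (Set.mem_univ i))
    (hc.comp hsc.continuousOn fun y hy => hy.2) ⟨fun i _ => hx i, hs⟩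

theorem exists_eq_inner_of_convForm_eq {d k : ℕ} {f : Rd d → ℝ} (hf : BddMeas f)
    (hc : ContinuousOn f (Metric.ball 0 1)) (hodd : ∀ x, f (-x) = -f x)
    (h : (k + 3) * convForm d (k + 1) f = weightedSq d (k + 2) f) :
    ∃ a : Rd d, ∀ x ∈ Metric.ball (0 : Rd d) 1, f x = inner ℝ a x := by
  have h0 : f 0 = 0 := by
    have := hodd 0
    rw [neg_zero] at this
    linarith
  obtain ⟨a, ha⟩ := exists_eq_inner_of_add (f := f)
    (hc.continuousAt (Metric.ball_mem_nhds 0 one_pos)) (by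
      intro x y hx hy hxy
      -- Evaluating at (x, y, 0, …, 0) with f 0 = 0 leaves two-variable additivity.
      have := sum_eq_of_convForm_eq hf hc hodd h
        (x := Fin.cons x (Fin.cons y fun _ => 0)) (by
          intro i
          refine Fin.cases (by simpa using hx) (fun i => ?_) i
          refine Fin.cases (by simpa using hy) (fun i => ?_) i
          simp) (by
          simpa [Fin.sum_univ_succ] using hxy)
      simpa [Fin.sum_univ_succ, h0] using this.symm)
  exact ⟨a, fun x hx => ha x (by simpa using hx)⟩

/-- The affine function `x ↦ a·x + b` cut off outside the ball. -/
def cutAffine (d : ℕ) (p : Rd d × ℝ) : Rd d → ℝ :=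
  (unitBall d).indicator fun x => inner ℝ p.1 x + p.2

theorem bddMeas_cutAffine (d : ℕ) (p : Rd d × ℝ) : BddMeas (cutAffine d p) :=
  bddMeas_indicator_unitBall (Continuous.measurable (by fun_prop))
    (Continuous.continuousOn (by fun_prop))

theorem affineMap_eq_lift (d k : ℕ) (hk : Even k) (p : Rd d × ℝ) :
    affineMap d ((k + 4 : ℕ) : ℝ) p = lift k (bddMeas_cutAffine d p) := by
  refine lift_eq_of_ae k _ ?_
  filter_upwards [(memLp_affineFun d ((k + 4 : ℕ) : ℝ) p).coeFn_toLp, ae_mem_unitBall d]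
    with x hx hxB
  refine hx.trans ?_
  rw [affineFun, weight, cutAffine, Set.indicator_of_mem hxB, Set.indicator_of_mem hxB,
    K_eq_ballPow d k hk]

theorem lift_eq_affineMap {d k : ℕ} (hk : Even k) {f : Rd d → ℝ} (hf : BddMeas f) {p : Rd d × ℝ}
    (h : ∀ x ∈ Metric.ball (0 : Rd d) 1, f x = inner ℝ p.1 x + p.2) :
    lift k hf = affineMap d ((k + 4 : ℕ) : ℝ) p := by
  rw [affineMap_eq_lift d k hk]
  refine lift_eq_of_ae k _ ?_
  filter_upwards [lift_ae k hf, ae_mem_ball d] with x hx hxB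
  rw [hx, h x hxB, cutAffine, Set.indicator_of_mem (ball_subset_unitBall d hxB)]

theorem reflectionₗᵢ_affineMap (d k : ℕ) (hk : Even k) (p : Rd d × ℝ) :
    reflectionₗᵢ d (affineMap d ((k + 4 : ℕ) : ℝ) p)
      = affineMap d ((k + 4 : ℕ) : ℝ) (-p.1, p.2) := by
  rw [affineMap_eq_lift d k hk p, reflectionₗᵢ_lift]
  refine lift_eq_affineMap hk _ fun x hx => ?_
  rw [cutAffine, Set.indicator_of_mem
    (neg_mem_unitBall.mpr (Metric.ball_subset_closedBall hx)), inner_neg_right, inner_neg_left]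

theorem compactPart_affineMap_const (d k : ℕ) (hk : Even k) (b : ℝ) :
    compactPart d k (affineMap d ((k + 4 : ℕ) : ℝ) (0, b))
      = affineMap d ((k + 4 : ℕ) : ℝ) (0, b) := by
  refine compactPart_eq_self_of_inner_eq_zero ?_
  rw [compactPart_of_even k (by rw [reflectionₗᵢ_affineMap d k hk]; simp), inner_sub_right,
    real_inner_self_eq_norm_sq, affineMap_eq_lift d k hk, norm_lift_sq, inner_lift_ballOp_lift]
  have h := integral_sub_sq d (k + 1) (bddMeas_cutAffine d (0, b))
  have h0 : ∫ x, ∫ y, (cutAffine d (0, b) x - cutAffine d (0, b) y) ^ 2 *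
      ballPow d (k + 1) (x - y) ∂ballMeasure d ∂ballMeasure d = 0 := by
    refine integral_eq_zero_of_ae ?_
    filter_upwards [ae_mem_unitBall d] with x hx
    refine integral_eq_zero_of_ae ?_
    filter_upwards [ae_mem_unitBall d] with y hy
    simp [cutAffine, hx, hy]
  linarith

/-- For linear f every square vanishes. The cutoff of f outside the ball is harmless, since the
weight 1_𝔹(∑ x_i) discards the configurations where it could matter. -/
theorem compactPart_affineMap_linear (d k : ℕ) (hk : Even k) (a : Rd d) :
    compactPart d k (affineMap d ((k + 4 : ℕ) : ℝ) (a, 0))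
      = affineMap d ((k + 4 : ℕ) : ℝ) (a, 0) := by
  refine compactPart_eq_self_of_inner_eq_zero ?_
  rw [compactPart_of_odd k (by
      rw [reflectionₗᵢ_affineMap d k hk, ← map_neg]; simp), inner_sub_right,
    real_inner_self_eq_norm_sq, inner_smul_right, affineMap_eq_lift d k hk, norm_lift_sq,
    inner_lift_ballOp_lift]
  have h := integral_sum_sub_sq d k (bddMeas_cutAffine d (a, 0)) (by
    intro x
    by_cases hx : x ∈ unitBall d
    · simp [cutAffine, hx, neg_mem_unitBall.mpr hx]
    · simp [cutAffine, hx, mt neg_mem_unitBall.mp hx])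
  have h0 : ∫ x, (∑ i, cutAffine d (a, 0) (x i) - cutAffine d (a, 0) (∑ i, x i)) ^ 2 *
      ballPow d 0 (∑ i, x i) ∂ballPi d (k + 3) = 0 := by
    refine integral_eq_zero_of_ae ?_
    rw [ballPi_eq_restrict]
    filter_upwards [ae_restrict_mem
      (MeasurableSet.univ_pi fun _ : Fin (k + 3) => measurableSet_unitBall d)] with x hx
    by_cases hs : ∑ i, x i ∈ unitBall d
    · have h1 : ∀ i, cutAffine d (a, 0) (x i) = inner ℝ a (x i) := fun i => by
        simp [cutAffine, hx i (Set.mem_univ i)]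
      have h2 : cutAffine d (a, 0) (∑ i, x i) = inner ℝ a (∑ i, x i) := by
        simp [cutAffine, hs]
      simp [h1, h2, inner_sum]
    · simp [ballPow_zero_of_notMem hs]
  rw [h0] at h
  have := (mul_eq_zero.mp h.symm).resolve_left (by positivity)
  linarith

theorem mem_H_iff (d k : ℕ) (hk : Even k) (h : L2Ball d) :
    h ∈ H d ((k + 4 : ℕ) : ℝ) ↔ compactPart d k h = h := by
  constructor
  · rintro ⟨⟨a, b⟩, rfl⟩
    have e : ((a, b) : Rd d × ℝ) = (a, 0) + (0, b) := by simp
    rw [e, map_add, map_add, compactPart_affineMap_const d k hk,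
      compactPart_affineMap_linear d k hk]
  · intro hC
    obtain ⟨he, ho⟩ := (compactPart_eq_self_iff d k h).mp hC
    rw [← evenPart_add_oddPart h]
    refine (H d ((k + 4 : ℕ) : ℝ)).add_mem ?_ ?_
    · obtain ⟨f, hf, hfc, hl⟩ := exists_lift_of_eq_smul_ballOp (c := 1)
        (by rw [one_smul]; exact he)
      have h1 : convForm d (k + 1) f = weightedSq d (k + 2) f := by
        rw [← norm_lift_sq k hf, ← inner_lift_ballOp_lift k hf, ← hl, he,
          real_inner_self_eq_norm_sq]
      rw [hl, lift_eq_affineMap hk hf (p := (0, f 0)) fun x hx => by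
        rw [eq_of_convForm_eq hf hfc h1 hx]; simp]
      exact ⟨_, rfl⟩
    · obtain ⟨g, hg, hgc, hl⟩ := exists_lift_of_eq_smul_ballOp ho
      -- The representative g is known to be odd only almost everywhere; antisymmetrizing makes it
      -- odd at every point without changing its lift.
      have hl' : oddPart h = lift k (bddMeas_odd hg) := by
        rw [← oddPart_lift k hg, ← hl]
        nth_rewrite 2 [oddPart]
        rw [reflectionₗᵢ_oddPart, sub_neg_eq_add, ← two_smul ℝ, smul_smul]
        norm_num
      have hc : ContinuousOn (fun x => (1 / 2 : ℝ) * (g x - g (-x))) (Metric.ball 0 1) :=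
        continuousOn_const.mul (hgc.sub (hgc.comp continuousOn_neg fun x hx => by simpa using hx))
      have h1 : (k + 3) * convForm d (k + 1) (fun x => (1 / 2 : ℝ) * (g x - g (-x)))
          = weightedSq d (k + 2) (fun x => (1 / 2 : ℝ) * (g x - g (-x))) := by
        rw [← norm_lift_sq k (bddMeas_odd hg), ← inner_lift_ballOp_lift k (bddMeas_odd hg), ← hl',
          ← inner_smul_right, ho, real_inner_self_eq_norm_sq]
      obtain ⟨a, ha⟩ := exists_eq_inner_of_convForm_eq (bddMeas_odd hg) hc
        (fun x => by rw [neg_neg]; ring) h1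
      rw [hl', lift_eq_affineMap hk (bddMeas_odd hg) (p := (a, 0)) fun x hx => by
        rw [ha x hx, add_zero]]
      exact ⟨_, rfl⟩

end BallSpectral

end

theorem mainTheorem4 (d : ℕ) (hd : 1 ≤ d) (q : ℕ) (hq : 4 ≤ q) (hq_even : Even q) :
    ∃ T : BallSpectral.L2Ball d →L[ℝ] BallSpectral.L2Ball d,
      BallSpectral.IsT d q T ∧ IsCompactOperator T ∧ IsSelfAdjoint T ∧
      ∃ c : ℝ, 0 < c ∧ ∀ h : BallSpectral.L2Ball d,
        -((q : ℝ) / 2) * ‖h‖ ^ 2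
            - (1 / 4 : ℝ) * q * (q - 2) * BallSpectral.Q T h (BallSpectral.reflection d h)
            + (1 / 4 : ℝ) * (q : ℝ) ^ 2 * BallSpectral.Q T h h
          ≤ -c * ‖h - (BallSpectral.H d q).starProjection h‖ ^ 2 := by
  obtain ⟨k, rfl⟩ := Nat.exists_eq_add_of_le' hq
  have hk : Even k := by
    rw [Nat.even_add] at hq_even
    exact hq_even.mpr (by decide)
  obtain ⟨c, hc, hgap⟩ := BallSpectral.exists_gap_of_isCompactOperator
    (BallSpectral.isCompactOperator_compactPart d k) (BallSpectral.inner_compactPart_symm d k)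
    (BallSpectral.inner_sub_compactPart_nonneg d k) (BallSpectral.H d ((k + 4 : ℕ) : ℝ))
    (BallSpectral.mem_H_iff d k hk)
  refine ⟨BallSpectral.ballOp d k, BallSpectral.isT_ballOp d k hk,
    BallSpectral.isCompactOperator_ballOp d k, ?_, ((k + 4 : ℕ) : ℝ) / 2 * c, by positivity,
    fun h => ?_⟩
  · rw [ContinuousLinearMap.isSelfAdjoint_iff_isSymmetric]
    exact fun x y => (BallSpectral.inner_ballOp_symm d k x y).symm
  -- The gap inequality times q/2: the coefficients q/2 and (q-2)/2 of C become q²/4 and q(q-2)/4.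
  · have h1 := mul_le_mul_of_nonneg_left (hgap h)
      (show (0 : ℝ) ≤ ((k + 4 : ℕ) : ℝ) / 2 by positivity)
    rw [inner_sub_right, real_inner_self_eq_norm_sq, BallSpectral.compactPart_apply,
      inner_sub_right, inner_smul_right, inner_smul_right] at h1
    rw [BallSpectral.Q, BallSpectral.Q, ← BallSpectral.reflectionₗᵢ_apply]
    push_cast at h1 ⊢
    linarith
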